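/- For $m\ge 1$, $y\ge 0$ let $\Delta_{m+1}^{(y)}=\{x\in(0,\infty)^{m+1}: x_1+\cdots+x_{m+1}=y\}$, equipped with the measure $dx_1\cdots dx_m$. Let $L\ge 0$ and $u\in\mathbb{R}$ with $|u|<\tfrac12$. For integers $2\le \ell\le k$ and $(w,v)\in \Delta_k^{(L/2)}\times\Delta_k^{(L/2)}$ define the edge-distance difference $d_1-d_\ell$ by $$ d_{j+1}-d_j=-w_j-w_{j+1}-z_j,\qquad z_j=-v_j+\log\frac{1-e^{-w_j}}{e^{w_{j+1}}-1}\qquad(1\le j\le k-1),$$ that is, $e^{d_{j+1}-d_j}=e^{v_j}\,\frac{1-e^{-w_{j+1}}}{e^{w_j}-1}$, and set $$E_{k,\ell}(L,u)=2^{k-1}\int_{\Delta_k^{(L/2)}\times\Delta_k^{(L/2)}} e^{2u(d_1-d_\ell)}\,dw_1\cdots dw_{k-1}\,dv_1\cdots dv_{k-1}.$$ Let $\hat X_{\mathrm B}(L,u,r)=\sum_{k=2}^\infty\sum_{\ell=2}^k r^{k-2}E_{k,\ell}(L,u)$ as a formal power series in $r$, and let $I_0(L\sqrt{2r})=\sum_{n\ge0}\frac{(L^2/2)^n}{(n!)^2}r^n$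 be the modified Bessel function, regarded as a formal power series in $r$. Then all the integrals $E_{k,\ell}(L,u)$ converge absolutely, and one has the identity of formal power series in $r$ $$\hat X_{\mathrm B}(L,u,r)=\frac{2\pi u}{\sin(2\pi u)}\sum_{p=0}^\infty\frac{u^{2p}}{(2p+1)!!}\,\frac{\partial^{p+1}}{\partial r^{p+1}}I_0(L\sqrt{2r}),$$ where the sum over $p$ converges coefficientwise and the prefactor is $1$ at $u=0$. -/

import Mathlib

open MeasureTheory
open scoped Nat PowerSeries PowerSeries.WithPiTopology

noncomputable section

/-- The open simplex `Δ_{m+1}^{(y)}` of all `x ∈ (0,∞)^{m+1}` with `x₁ + ⋯ + x_{m+1} = y`. -/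
def openSimplex (m : ℕ) (y : ℝ) : Set (Fin (m + 1) → ℝ) :=
  {x | (∀ i, 0 < x i) ∧ ∑ i, x i = y}

/-- Parametrisation of the hyperplane `x₁ + ⋯ + x_{m+1} = y` by its first `m` coordinates. -/
def simplexChart (m : ℕ) (y : ℝ) (x : Fin m → ℝ) : Fin (m + 1) → ℝ :=
  Fin.snoc x (y - ∑ i, x i)

theorem sum_simplexChart (m : ℕ) (y : ℝ) (x : Fin m → ℝ) :
    ∑ i, simplexChart m y x i = y := by
  simp [simplexChart, Fin.sum_univ_castSucc]

theorem measurable_simplexChart (m : ℕ) (y : ℝ) : Measurable (simplexChart m y) := by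
  refine measurable_pi_lambda _ fun i => ?_
  refine Fin.lastCases ?_ (fun j => ?_) i
  · simp only [simplexChart, Fin.snoc_last]
    fun_prop
  · simp only [simplexChart, Fin.snoc_castSucc]
    fun_prop

/-- The Lebesgue measure `dx₁ ⋯ dx_m` on the open simplex `Δ_{m+1}^{(y)}`. -/
def simplexMeasure (m : ℕ) (y : ℝ) : Measure (Fin (m + 1) → ℝ) :=
  (volume.restrict {x | simplexChart m y x ∈ openSimplex m y}).map (simplexChart m y)

/-- The shear of the corner between the (consecutive) edges number `j + 1` and `j + 2` around a
boundary vertex of degree `m + 1` with decoration `(w, v)`. -/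
def cornerShear {m : ℕ} (w v : Fin (m + 1) → ℝ) (j : Fin m) : ℝ :=
  -v j.castSucc + Real.log ((1 - Real.exp (-w j.castSucc)) / (Real.exp (w j.succ) - 1))

/-- The increment `d_{j+2} - d_{j+1}` of the edge distance between consecutive edges, determined by
`d' + z' = d - z - z_c` where the half-shears `z`, `z'` of the two edges are their `w`-coordinates
and `z_c` is the shear of the corner between them. -/
def edgeDistStep {m : ℕ} (w v : Fin (m + 1) → ℝ) (j : Fin m) : ℝ :=
  -w j.castSucc - cornerShear w v j - w j.succ

/-- The difference `d₁ - d_ℓ` of the edge distances of the first and the `ℓ`-th edge (the edges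
being numbered `1, …, m + 1`), obtained by telescoping. -/
def edgeDistDiff {m : ℕ} (ℓ : ℕ) (w v : Fin (m + 1) → ℝ) : ℝ :=
  -∑ j ∈ Finset.univ.filter (fun j : Fin m => (j : ℕ) + 1 < ℓ), edgeDistStep w v j

/-- The integrand `exp (2 u (d₁ - d_ℓ))`, as a function of the decoration `(w, v)`. -/
def boundaryIntegrand (m ℓ : ℕ) (u : ℝ) (q : (Fin (m + 1) → ℝ) × (Fin (m + 1) → ℝ)) : ℝ :=
  Real.exp (2 * u * edgeDistDiff ℓ q.1 q.2)

/-- The measure `∏_{j=1}^{k-1} dw_j dv_j` on the polytope `Δ_k^{(L/2)} × Δ_k^{(L/2)}`, `k ≥ 1`. -/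
def polytopeMeasure (k : ℕ) (L : ℝ) :
    Measure ((Fin (k - 1 + 1) → ℝ) × (Fin (k - 1 + 1) → ℝ)) :=
  (simplexMeasure (k - 1) (L / 2)).prod (simplexMeasure (k - 1) (L / 2))

/-- `E_{k,ℓ}(L,u)`, for `2 ≤ ℓ ≤ k`: the integral of `exp (2 u (d₁ - d_ℓ))` over the polytope
`Δ_k^{(L/2)} × Δ_k^{(L/2)}` with respect to the normalised measure `2^{k-1} ∏ dw_j dv_j`. -/
def boundaryE (k ℓ : ℕ) (L u : ℝ) : ℝ :=
  2 ^ (k - 1) * ∫ q, boundaryIntegrand (k - 1) ℓ u q ∂(polytopeMeasure k L)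

/-- The generating function `∑_{k ≥ 2} ∑_{ℓ=2}^{k} r^{k-2} E_{k,ℓ}(L,u)`, a formal power series
in `r` (the coefficient of `r^n` is the contribution of `k = n + 2`). -/
def hatXB (L u : ℝ) : ℝ⟦X⟧ :=
  PowerSeries.mk fun n => ∑ ℓ ∈ Finset.Icc 2 (n + 2), boundaryE (n + 2) ℓ L u

/-- The modified Bessel function `I₀`. -/
def besselI0 (x : ℝ) : ℝ := ∑' n : ℕ, (x / 2) ^ (2 * n) / (n ! : ℝ) ^ 2

/-- `I₀(L √(2r)) = ∑ₙ (L² r / 2)ⁿ / (n!)²` as a formal power series in `r`. -/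
def besselI0Series (L : ℝ) : ℝ⟦X⟧ :=
  PowerSeries.mk fun n => (L ^ 2 / 2) ^ n / (n ! : ℝ) ^ 2

theorem hasSum_besselI0Series (L r : ℝ) (hr : 0 ≤ r) :
    HasSum (fun n => PowerSeries.coeff n (besselI0Series L) * r ^ n)
      (besselI0 (L * Real.sqrt (2 * r))) := by
  have h : ∀ n : ℕ, (L * Real.sqrt (2 * r) / 2) ^ (2 * n) / (n ! : ℝ) ^ 2 =
      PowerSeries.coeff n (besselI0Series L) * r ^ n := by
    intro n
    have h2 : (L * Real.sqrt (2 * r) / 2) ^ 2 = L ^ 2 / 2 * r := by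
      rw [div_pow, mul_pow, Real.sq_sqrt (by positivity)]
      ring
    rw [pow_mul, h2, besselI0Series, PowerSeries.coeff_mk, mul_pow]
    ring
  have hs : Summable fun n : ℕ => (L * Real.sqrt (2 * r) / 2) ^ (2 * n) / (n ! : ℝ) ^ 2 := by
    refine Summable.of_nonneg_of_le (fun n => ?_) (fun n => ?_)
      (Real.summable_pow_div_factorial ((L * Real.sqrt (2 * r) / 2) ^ 2))
    · rw [pow_mul]; positivity
    · rw [pow_mul]
      have h1 : (1 : ℝ) ≤ (n ! : ℝ) := by exact_mod_cast Nat.one_le_iff_ne_zero.2 n.factorial_ne_zero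
      gcongr
      nlinarith
  have := hs.hasSum
  simpa only [h, besselI0] using this

/-- `2πu / sin(2πu)`, with its limit value `1` at `u = 0`. -/
def sinePrefactor (u : ℝ) : ℝ :=
  if u = 0 then 1 else 2 * Real.pi * u / Real.sin (2 * Real.pi * u)

/-- The formal power series `u^{2p} / (2p+1)!! · ∂_r^{p+1} I₀(L √(2r))` in `r`. -/
def besselTerm (L u : ℝ) (p : ℕ) : ℝ⟦X⟧ :=
  PowerSeries.C (u ^ (2 * p) / ((2 * p + 1)‼ : ℝ)) *
    (PowerSeries.derivative ℝ)^[p + 1] (besselI0Series L)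

end

/-! Put `k = i + j + 2`, `ℓ = i + 2` and `λ(x) = log (1 - e^{-x})`. The edge distances telescope to
`d₁ - d_ℓ = ∑_{t<ℓ} (w_t - v_t) + λ(w₁) - λ(w_ℓ)`, so the integrand is a product of functions of
single coordinates and each simplex integral is an iterated convolution on the half-line, evaluated
at `L/2`.

In the `w`-integral the only kernels that are not exponentials are those of `w₁` and `w_ℓ`.
Convolution is commutative and associative, so these two may be convolved with each other first. The
substitution behind `lintegral_Ioo_exp_logOneSubExpNeg` turns that convolution into a Beta integral;
by Euler's reflection formula the result is `2πu / sin 2πu` times the convolution of `e^{2ux}` with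
`1` (`firstKernel_lconvolution_lastKernel`). Hence `E_{k,ℓ}` is `2^{k-1}` times this prefactor times
`S(2u) S(-2u)`, where `S` is `simplexExpIntegral i j` at `L/2` (`boundaryE_eq`). Computing with
values in `[0, ∞]` yields absolute convergence at the same time.

After rescaling, `S(a) S(-a)` is an integral of `e^{a(x-y)}` over the unit square. By symmetry in
`x, y` the exponential may be replaced by `cosh`, whose Taylor coefficients are two-variable Selberg
integrals (`integral_selbergIntegrand`). Summing over `i + j = n` is a Vandermonde convolution
(`sum_antidiagonal_integral_selbergIntegrand`), and the outcome is the coefficient of `r^n` in the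
Bessel terms (`coeff_besselTerm`). -/

open scoped ENNReal

/-! ### The two-variable Selberg integral with integer exponents -/

/-- Lebesgue measure on the unit square. -/
noncomputable def unitSquare : Measure (ℝ × ℝ) :=
  (volume.restrict (Set.Icc 0 1)).prod (volume.restrict (Set.Icc 0 1))

theorem unitSquare_eq_restrict :
    unitSquare = volume.restrict (Set.Icc (0 : ℝ) 1 ×ˢ Set.Icc (0 : ℝ) 1) := by
  rw [unitSquare, Measure.prod_restrict, Measure.volume_eq_prod]

instance : IsFiniteMeasure unitSquare := by
  unfold unitSquare; infer_instance

theorem Continuous.integrable_unitSquare {f : ℝ × ℝ → ℝ} (hf : Continuous f) :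
    Integrable f unitSquare := by
  rw [unitSquare_eq_restrict]
  exact hf.continuousOn.integrableOn_compact (isCompact_Icc.prod isCompact_Icc)

theorem integral_unitSquare_swap (f : ℝ × ℝ → ℝ) :
    ∫ z, f z.swap ∂unitSquare = ∫ z, f z ∂unitSquare :=
  integral_prod_swap f

/-- Integration by parts in Aomoto's style: `G'` integrates to zero in its first variable, and so
does its reflection. Adding the reflection is what later cancels the odd power `(x - y)^{2p-1}`. -/
theorem integral_unitSquare_deriv_add_swap_eq_zero {G G' : ℝ × ℝ → ℝ}
    (hG : ∀ x y, HasDerivAt (fun t => G (t, y)) (G' (x, y)) x) (hc : Continuous G')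
    (h0 : ∀ y, G (0, y) = 0) (h1 : ∀ y, G (1, y) = 0) :
    ∫ z, (G' z + G' z.swap) ∂unitSquare = 0 := by
  have key : ∫ z, G' z ∂unitSquare = 0 := by
    have hi := hc.integrable_unitSquare
    unfold unitSquare at hi ⊢
    rw [integral_prod_symm _ hi]
    refine integral_eq_zero_of_ae (Filter.Eventually.of_forall fun y => ?_)
    have := intervalIntegral.integral_eq_sub_of_hasDerivAt (a := 0) (b := 1)
      (f := fun t => G (t, y)) (f' := fun t => G' (t, y)) (fun x _ => hG x y)
      ((hc.comp (by fun_prop : Continuous fun t : ℝ => (t, y))).intervalIntegrable _ _)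
    rw [intervalIntegral.integral_of_le zero_le_one, ← integral_Icc_eq_integral_Ioc] at this
    simpa [h0, h1] using this
  have hs : Integrable (fun z => G' z.swap) unitSquare :=
    (hc.comp continuous_swap).integrable_unitSquare
  rw [integral_add hc.integrable_unitSquare hs, integral_unitSquare_swap, key, add_zero]

/-- The integrand of the two-variable Selberg integral. -/
def selbergIntegrand (i j p : ℕ) (z : ℝ × ℝ) : ℝ :=
  (z.1 - z.2) ^ (2 * p) * (z.1 * z.2) ^ i * ((1 - z.1) * (1 - z.2)) ^ j

@[fun_prop]
theorem continuous_selbergIntegrand (i j p : ℕ) : Continuous (selbergIntegrand i j p) := by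
  unfold selbergIntegrand; fun_prop

/-- The factor `2p` makes the truncated exponent `2p - 1` harmless at `p = 0`. -/
theorem two_mul_pow_pred_mul (p : ℕ) (t : ℝ) :
    ((2 * p : ℕ) : ℝ) * t ^ (2 * p - 1) * t = (2 * p : ℕ) * t ^ (2 * p) := by
  rcases p with _ | p
  · simp
  · rw [mul_assoc, ← pow_succ]; rfl

theorem two_mul_neg_pow_pred (p : ℕ) (t : ℝ) :
    ((2 * p : ℕ) : ℝ) * (-t) ^ (2 * p - 1) = -((2 * p : ℕ) * t ^ (2 * p - 1)) := by
  rcases p with _ | p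
  · simp
  · rw [show 2 * (p + 1) - 1 = 2 * p + 1 by omega, Odd.neg_pow ⟨p, rfl⟩]; ring

theorem hasDerivAt_selberg_aux (i j p : ℕ) (x y : ℝ) :
    HasDerivAt (fun t : ℝ => t ^ (i + 1) * (1 - t) ^ (j + 1) * (t - y) ^ (2 * p))
      (((i + 1) * (1 - x) - (j + 1) * x) * (x ^ i * (1 - x) ^ j) * (x - y) ^ (2 * p) +
        x * (1 - x) * (x ^ i * (1 - x) ^ j) * ((2 * p : ℕ) * (x - y) ^ (2 * p - 1))) x := by
  have h1 := hasDerivAt_pow (i + 1) x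
  have h2 := ((hasDerivAt_id x).const_sub 1).pow (j + 1)
  have h3 := ((hasDerivAt_id x).sub_const y).pow (2 * p)
  refine ((h1.mul h2).mul h3).congr_deriv ?_
  simp
  ring

/-- With `Φ` the Selberg integrand, integrate `∂ₓ(x(1-x)Φ)`. In the symmetrised sum `x(1-x) - y(1-y)
= (x-y)(1-x-y)` supplies the missing factor `x - y`, leaving `2(i+1+p) - (i+j+2+2p)(x+y)` times `Φ`.
-/
theorem integral_add_mul_selbergIntegrand (i j p : ℕ) :
    (i + j + 2 + 2 * p) * ∫ z, (z.1 + z.2) * selbergIntegrand i j p z ∂unitSquare =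
      2 * (i + 1 + p) * ∫ z, selbergIntegrand i j p z ∂unitSquare := by
  have h := integral_unitSquare_deriv_add_swap_eq_zero
    (G := fun z => z.1 ^ (i + 1) * (1 - z.1) ^ (j + 1) * (z.1 - z.2) ^ (2 * p) *
      (z.2 ^ i * (1 - z.2) ^ j))
    (G' := fun z => (((i + 1) * (1 - z.1) - (j + 1) * z.1) * (z.1 ^ i * (1 - z.1) ^ j) *
      (z.1 - z.2) ^ (2 * p) + z.1 * (1 - z.1) * (z.1 ^ i * (1 - z.1) ^ j) *
      ((2 * p : ℕ) * (z.1 - z.2) ^ (2 * p - 1))) * (z.2 ^ i * (1 - z.2) ^ j))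
    (fun x y => (hasDerivAt_selberg_aux i j p x y).mul_const (y ^ i * (1 - y) ^ j)) (by fun_prop)
    (by simp) (by simp)
  have h' : ∫ z, (2 * (i + 1 + p) * selbergIntegrand i j p z -
      (i + j + 2 + 2 * p) * ((z.1 + z.2) * selbergIntegrand i j p z)) ∂unitSquare = 0 := by
    rw [← h]
    congr 1
    ext ⟨x, y⟩
    have e1 := two_mul_pow_pred_mul p (x - y)
    have e2 := two_mul_neg_pow_pred p (x - y)
    have e3 : (y - x) ^ (2 * p) = (x - y) ^ (2 * p) := by
      rw [← neg_sub, (even_two_mul p).neg_pow]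
    rw [neg_sub] at e2
    simp only [selbergIntegrand, Prod.swap, e2, e3, mul_pow]
    push_cast at e1 ⊢
    linear_combination -(x ^ i * y ^ i * (1 - x) ^ j * (1 - y) ^ j * (1 - x - y)) * e1
  rw [integral_sub (Continuous.integrable_unitSquare (by fun_prop))
    (Continuous.integrable_unitSquare (by fun_prop)), integral_const_mul, integral_const_mul] at h'
  linarith

/-- The same argument with `∂ₓ(x(1-x)yΦ)`: now `xy(1-x) - xy(1-y) = -xy(x-y)`, and `xyΦ` is the
integrand with `i` raised by one. -/
theorem integral_mul_mul_selbergIntegrand (i j p : ℕ) :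
    2 * (i + j + 2 + p) * ∫ z, selbergIntegrand (i + 1) j p z ∂unitSquare =
      (i + 1) * ∫ z, (z.1 + z.2) * selbergIntegrand i j p z ∂unitSquare := by
  have h := integral_unitSquare_deriv_add_swap_eq_zero
    (G := fun z => z.1 ^ (i + 1) * (1 - z.1) ^ (j + 1) * (z.1 - z.2) ^ (2 * p) *
      (z.2 ^ (i + 1) * (1 - z.2) ^ j))
    (G' := fun z => (((i + 1) * (1 - z.1) - (j + 1) * z.1) * (z.1 ^ i * (1 - z.1) ^ j) *
      (z.1 - z.2) ^ (2 * p) + z.1 * (1 - z.1) * (z.1 ^ i * (1 - z.1) ^ j) *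
      ((2 * p : ℕ) * (z.1 - z.2) ^ (2 * p - 1))) * (z.2 ^ (i + 1) * (1 - z.2) ^ j))
    (fun x y => (hasDerivAt_selberg_aux i j p x y).mul_const (y ^ (i + 1) * (1 - y) ^ j)) (by fun_prop)
    (by simp) (by simp)
  have h' : ∫ z, ((i + 1) * ((z.1 + z.2) * selbergIntegrand i j p z) -
      2 * (i + j + 2 + p) * selbergIntegrand (i + 1) j p z) ∂unitSquare = 0 := by
    rw [← h]
    congr 1
    ext ⟨x, y⟩
    have e1 := two_mul_pow_pred_mul p (x - y)
    have e2 := two_mul_neg_pow_pred p (x - y)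
    have e3 : (y - x) ^ (2 * p) = (x - y) ^ (2 * p) := by
      rw [← neg_sub, (even_two_mul p).neg_pow]
    rw [neg_sub] at e2
    simp only [selbergIntegrand, Prod.swap, e2, e3, mul_pow]
    push_cast at e1 ⊢
    linear_combination (x ^ i * y ^ i * (1 - x) ^ j * (1 - y) ^ j * (x * y)) * e1
  rw [integral_sub (Continuous.integrable_unitSquare (by fun_prop))
    (Continuous.integrable_unitSquare (by fun_prop)), integral_const_mul, integral_const_mul] at h'
  linarith

theorem integral_selbergIntegrand_succ_left (i j p : ℕ) :
    ((i + j + 2 + 2 * p) * (i + j + 2 + p) : ℝ) * ∫ z, selbergIntegrand (i + 1) j p z ∂unitSquare =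
      (i + 1) * (i + 1 + p) * ∫ z, selbergIntegrand i j p z ∂unitSquare := by
  linear_combination (i + j + 2 + 2 * p : ℝ) / 2 * integral_mul_mul_selbergIntegrand i j p +
    (i + 1 : ℝ) / 2 * integral_add_mul_selbergIntegrand i j p

/-- Follows from `(1-x)(1-y) = 1 - (x+y) + xy` and the preceding relations. -/
theorem integral_selbergIntegrand_succ_right (i j p : ℕ) :
    ((i + j + 2 + 2 * p) * (i + j + 2 + p) : ℝ) * ∫ z, selbergIntegrand i (j + 1) p z ∂unitSquare =
      (j + 1) * (j + 1 + p) * ∫ z, selbergIntegrand i j p z ∂unitSquare := by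
  have h : ∫ z, selbergIntegrand i (j + 1) p z ∂unitSquare =
      ∫ z, selbergIntegrand i j p z ∂unitSquare -
        ∫ z, (z.1 + z.2) * selbergIntegrand i j p z ∂unitSquare +
        ∫ z, selbergIntegrand (i + 1) j p z ∂unitSquare := by
    rw [← integral_sub (Continuous.integrable_unitSquare (by fun_prop))
      (Continuous.integrable_unitSquare (by fun_prop)),
      ← integral_add (Continuous.integrable_unitSquare (by fun_prop))
      (Continuous.integrable_unitSquare (by fun_prop))]
    congr 1
    ext z
    simp only [selbergIntegrand]
    ring
  rw [h]
  linear_combination integral_selbergIntegrand_succ_left i j p -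
    (i + j + 2 + p : ℝ) * integral_add_mul_selbergIntegrand i j p

theorem integral_selbergIntegrand_zero_zero (p : ℕ) :
    ((2 * p + 1) * (p + 1) : ℝ) * ∫ z, selbergIntegrand 0 0 p z ∂unitSquare = 1 := by
  have hi := (continuous_selbergIntegrand 0 0 p).integrable_unitSquare
  have inner (x : ℝ) : ∫ y in Set.Icc (0 : ℝ) 1, selbergIntegrand 0 0 p (x, y) =
      (x ^ (2 * p + 1) + (1 - x) ^ (2 * p + 1)) / (2 * p + 1) := by
    rw [integral_Icc_eq_integral_Ioc, ← intervalIntegral.integral_of_le zero_le_one]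
    simp only [selbergIntegrand, pow_zero, mul_one]
    rw [intervalIntegral.integral_comp_sub_left (fun t => t ^ (2 * p)), integral_pow,
      ← neg_sub 1 x, Odd.neg_pow ⟨p, rfl⟩]
    push_cast; ring
  unfold unitSquare at hi ⊢
  rw [integral_prod _ hi]
  simp only [inner]
  rw [integral_Icc_eq_integral_Ioc, ← intervalIntegral.integral_of_le zero_le_one,
    intervalIntegral.integral_div, intervalIntegral.integral_add
      (Continuous.intervalIntegrable (by fun_prop) _ _)
      (Continuous.intervalIntegrable (by fun_prop) _ _),
    intervalIntegral.integral_comp_sub_left (fun t => t ^ (2 * p + 1)), sub_self, sub_zero,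
    integral_pow]
  push_cast
  field_simp
  norm_num
  ring

/-- The two-variable Selberg integral with integer parameters. -/
theorem integral_selbergIntegrand (i j p : ℕ) :
    ∫ z, selbergIntegrand i j p z ∂unitSquare =
      (i ! * j ! * (i + p)! * (j + p)! * (2 * p)! : ℝ) /
        ((i + j + 1 + p)! * (i + j + 1 + 2 * p)! * p !) := by
  induction i with
  | zero =>
    induction j with
    | zero =>
      have h := integral_selbergIntegrand_zero_zero p
      have e1 : (((0 + 0 + 1 + p)! : ℕ) : ℝ) = (p + 1) * p ! := by
        rw [show 0 + 0 + 1 + p = p + 1 by omega, Nat.factorial_succ]; push_cast; ring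
      have e2 : (((0 + 0 + 1 + 2 * p)! : ℕ) : ℝ) = (2 * p + 1) * (2 * p)! := by
        rw [show 0 + 0 + 1 + 2 * p = 2 * p + 1 by omega, Nat.factorial_succ]; push_cast; ring
      rw [e1, e2]
      have := Nat.factorial_ne_zero p
      have := Nat.factorial_ne_zero (2 * p)
      simp only [zero_add, Nat.factorial_zero, Nat.cast_one]
      field_simp
      linear_combination h
    | succ j ih =>
      have h := integral_selbergIntegrand_succ_right 0 j p
      rw [ih] at h
      have e1 : (((0 + (j + 1) + 1 + p)! : ℕ) : ℝ) = (j + 2 + p) * (0 + j + 1 + p)! := by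
        rw [show 0 + (j + 1) + 1 + p = (0 + j + 1 + p) + 1 by omega, Nat.factorial_succ]
        push_cast; ring
      have e2 : (((0 + (j + 1) + 1 + 2 * p)! : ℕ) : ℝ) =
          (j + 2 + 2 * p) * (0 + j + 1 + 2 * p)! := by
        rw [show 0 + (j + 1) + 1 + 2 * p = (0 + j + 1 + 2 * p) + 1 by omega, Nat.factorial_succ]
        push_cast; ring
      have e3 : (((j + 1 + p)! : ℕ) : ℝ) = (j + 1 + p) * (j + p)! := by
        rw [show j + 1 + p = (j + p) + 1 by omega, Nat.factorial_succ]; push_cast; ring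
      rw [e1, e2, e3, Nat.factorial_succ]
      have := Nat.factorial_ne_zero (0 + j + 1 + p)
      have := Nat.factorial_ne_zero (0 + j + 1 + 2 * p)
      have := Nat.factorial_ne_zero p
      have h2 : ((j + 2 + 2 * p) * (j + 2 + p) : ℝ) ≠ 0 := by positivity
      apply mul_left_cancel₀ h2
      push_cast at h ⊢
      rw [show ((j + 2 + 2 * p) * (j + 2 + p) : ℝ) = (0 + j + 2 + 2 * p) * (0 + j + 2 + p) by ring,
        h]
      field_simp
      ring
  | succ i ih =>
    have h := integral_selbergIntegrand_succ_left i j p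
    rw [ih] at h
    have e1 : (((i + 1 + j + 1 + p)! : ℕ) : ℝ) = (i + j + 2 + p) * (i + j + 1 + p)! := by
      rw [show i + 1 + j + 1 + p = (i + j + 1 + p) + 1 by omega, Nat.factorial_succ]
      push_cast; ring
    have e2 : (((i + 1 + j + 1 + 2 * p)! : ℕ) : ℝ) =
        (i + j + 2 + 2 * p) * (i + j + 1 + 2 * p)! := by
      rw [show i + 1 + j + 1 + 2 * p = (i + j + 1 + 2 * p) + 1 by omega, Nat.factorial_succ]
      push_cast; ring
    have e3 : (((i + 1 + p)! : ℕ) : ℝ) = (i + 1 + p) * (i + p)! := by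
      rw [show i + 1 + p = (i + p) + 1 by omega, Nat.factorial_succ]; push_cast; ring
    rw [e1, e2, e3, Nat.factorial_succ]
    have := Nat.factorial_ne_zero (i + j + 1 + p)
    have := Nat.factorial_ne_zero (i + j + 1 + 2 * p)
    have := Nat.factorial_ne_zero p
    have h2 : ((i + j + 2 + 2 * p) * (i + j + 2 + p) : ℝ) ≠ 0 := by positivity
    apply mul_left_cancel₀ h2
    rw [h]
    push_cast
    field_simp

/-! ### Summation of Selberg integrals over `i + j = n` -/

/-- The Vandermonde-type convolution `∑ C(i+p,p) C(j+p,p) = C(n+2p+1,2p+1)`. -/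
theorem sum_antidiagonal_add_choose_mul_add_choose (n p : ℕ) :
    ∑ q ∈ Finset.HasAntidiagonal.antidiagonal n, (p + q.1).choose p * (p + q.2).choose p =
      (2 * p + 1 + n).choose (2 * p + 1) := by
  -- Compare coefficients of `X^n` in `(1-X)^{-(2p+2)} = (1-X)^{-(p+1)} (1-X)^{-(p+1)}`.
  have h := congrArg (fun s : ℤ⟦X⟧ˣ => PowerSeries.coeff n s.val)
    (PowerSeries.invOneSubPow_add ℤ (p + 1) (p + 1))
  simp only [Units.val_mul, show p + 1 + (p + 1) = 2 * p + 1 + 1 by ring,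
    PowerSeries.invOneSubPow_val_succ_eq_mk_add_choose, PowerSeries.coeff_mul,
    PowerSeries.coeff_mk] at h
  exact_mod_cast h.symm

/-- The moments of the difference of the two coordinates under the density
`∑_{i+j=n} (x y)^i ((1-x)(1-y))^j / (i! j!)^2` on the unit square. -/
theorem sum_antidiagonal_integral_selbergIntegrand (n p : ℕ) :
    ∑ q ∈ Finset.HasAntidiagonal.antidiagonal n,
      (∫ z, selbergIntegrand q.1 q.2 p z ∂unitSquare) / ((q.1 ! : ℝ) * q.2 !) ^ 2 =
    (p ! : ℝ) / ((2 * p + 1) * ((n + p + 1)! * n !)) := by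
  -- For fixed `i + j = n` the only dependence on `(i, j)` is through the two binomial coefficients.
  have h1 : ∀ q ∈ Finset.HasAntidiagonal.antidiagonal n,
      (∫ z, selbergIntegrand q.1 q.2 p z ∂unitSquare) / ((q.1 ! : ℝ) * q.2 !) ^ 2 =
      ((p + q.1).choose p * (p + q.2).choose p : ℕ) *
        ((p ! * (2 * p)! : ℝ) / ((n + p + 1)! * (2 * p + 1 + n)!)) := by
    rintro ⟨i, j⟩ hq
    obtain rfl := Finset.HasAntidiagonal.mem_antidiagonal.1 hq
    rw [integral_selbergIntegrand, Nat.cast_mul, Nat.cast_add_choose, Nat.cast_add_choose,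
      show i + j + 1 + p = i + j + p + 1 by omega,
      show i + j + 1 + 2 * p = 2 * p + 1 + (i + j) by omega, add_comm p i, add_comm p j]
    have := Nat.factorial_ne_zero i
    have := Nat.factorial_ne_zero j
    have := Nat.factorial_ne_zero p
    have := Nat.factorial_ne_zero (i + j + p + 1)
    have := Nat.factorial_ne_zero (2 * p + 1 + (i + j))
    simp only
    field_simp
  rw [Finset.sum_congr rfl h1, ← Finset.sum_mul, ← Nat.cast_sum,
    sum_antidiagonal_add_choose_mul_add_choose, Nat.cast_add_choose, Nat.factorial_succ (2 * p)]
  have := Nat.factorial_ne_zero n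
  have := Nat.factorial_ne_zero (2 * p)
  have := Nat.factorial_ne_zero (n + p + 1)
  have := Nat.factorial_ne_zero (2 * p + 1 + n)
  push_cast
  field_simp

/-! ### Beta integrals and the convolution of the singular kernels -/

theorem lintegral_Ioo_rpow_mul_one_sub_rpow {b : ℝ} (hb0 : 0 < b) (hb1 : b < 1) :
    ∫⁻ x in Set.Ioo (0 : ℝ) 1, ENNReal.ofReal (x ^ (-b) * (1 - x) ^ (b - 1)) =
      ENNReal.ofReal (Real.pi / Real.sin (Real.pi * b)) := by
  have hB : ProbabilityTheory.beta (1 - b) b = Real.pi / Real.sin (Real.pi * b) := by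
    rw [ProbabilityTheory.beta, mul_comm, Real.Gamma_mul_Gamma_one_sub]; simp
  have hpos : 0 < ProbabilityTheory.beta (1 - b) b :=
    ProbabilityTheory.beta_pos (by linarith) hb0
  have h := ProbabilityTheory.lintegral_betaPDF_eq_one (by linarith : 0 < 1 - b) hb0
  rw [ProbabilityTheory.lintegral_betaPDF] at h
  rw [← hB]
  calc _ = ∫⁻ x in Set.Ioo (0 : ℝ) 1, ENNReal.ofReal (ProbabilityTheory.beta (1 - b) b) *
        ENNReal.ofReal (1 / ProbabilityTheory.beta (1 - b) b * x ^ (1 - b - 1) *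
          (1 - x) ^ (b - 1)) := by
        refine lintegral_congr fun x => ?_
        rw [← ENNReal.ofReal_mul hpos.le]
        congr 1
        rw [show 1 - b - 1 = -b by ring]
        field_simp
    _ = _ := by rw [lintegral_const_mul _ (by fun_prop), h, mul_one]

/-- The Beta integral after the substitution `t = y / (1 - y)`. -/
theorem lintegral_Ioi_rpow_div_one_add {b : ℝ} (hb0 : 0 < b) (hb1 : b < 1) :
    ∫⁻ t in Set.Ioi (0 : ℝ), ENNReal.ofReal (t ^ (-b) / (1 + t)) =
      ENNReal.ofReal (Real.pi / Real.sin (Real.pi * b)) := by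
  have him : (fun y : ℝ => y / (1 - y)) '' Set.Ioo 0 1 = Set.Ioi 0 := by
    ext t
    constructor
    · rintro ⟨y, ⟨h0, h1⟩, rfl⟩
      exact div_pos h0 (by linarith)
    · intro ht
      have ht' : 0 < t := ht
      refine ⟨t / (1 + t), ⟨by positivity, (div_lt_one (by positivity)).2 (by linarith)⟩, ?_⟩
      field_simp
      ring
  have hinj : Set.InjOn (fun y : ℝ => y / (1 - y)) (Set.Ioo 0 1) := by
    rintro x ⟨_, hx⟩ y ⟨_, hy⟩ h
    have h1 : 1 - x ≠ 0 := by linarith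
    have h2 : 1 - y ≠ 0 := by linarith
    simp only at h
    rw [div_eq_div_iff h1 h2] at h
    linarith
  rw [← him, lintegral_image_eq_lintegral_abs_deriv_mul (f' := fun y => 1 / (1 - y) ^ 2)
    measurableSet_Ioo _ hinj, ← lintegral_Ioo_rpow_mul_one_sub_rpow hb0 hb1]
  · refine setLIntegral_congr_fun measurableSet_Ioo ?_
    rintro y ⟨h0, h1⟩
    have h2 : 0 < 1 - y := by linarith
    simp only
    rw [← ENNReal.ofReal_mul (abs_nonneg _), abs_of_nonneg (by positivity),
      Real.div_rpow h0.le h2.le, Real.rpow_sub h2, Real.rpow_neg h2.le, Real.rpow_one]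
    congr 1
    have : 0 < (1 - y) ^ b := Real.rpow_pos_of_pos h2 b
    have h3 : 1 + y / (1 - y) = 1 / (1 - y) := by field_simp; ring
    rw [h3]
    field_simp
  · rintro y ⟨h0, h1⟩
    have h2 : 1 - y ≠ 0 := by linarith
    have := (hasDerivAt_id y).div ((hasDerivAt_id y).const_sub 1) h2
    refine (this.congr_deriv ?_).hasDerivWithinAt
    simp

theorem integrableOn_Ioi_rpow_div_one_add {b : ℝ} (hb0 : 0 < b) (hb1 : b < 1) :
    IntegrableOn (fun t : ℝ => t ^ (-b) / (1 + t)) (Set.Ioi 0) := by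
  refine ⟨Measurable.aestronglyMeasurable (by fun_prop), ?_⟩
  rw [hasFiniteIntegral_iff_ofReal, lintegral_Ioi_rpow_div_one_add hb0 hb1]
  · exact ENNReal.ofReal_lt_top
  · filter_upwards [ae_restrict_mem measurableSet_Ioi] with t ht
    have : (0 : ℝ) < t := ht
    simp only [Pi.zero_apply]
    positivity

theorem integral_Ioi_rpow_div_one_add {b : ℝ} (hb0 : 0 < b) (hb1 : b < 1) :
    ∫ t in Set.Ioi (0 : ℝ), t ^ (-b) / (1 + t) = Real.pi / Real.sin (Real.pi * b) := by
  have hs : 0 < Real.sin (Real.pi * b) :=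
    Real.sin_pos_of_pos_of_lt_pi (by positivity) (by nlinarith [Real.pi_pos])
  rw [integral_eq_lintegral_of_nonneg_ae _ (Measurable.aestronglyMeasurable (by fun_prop)),
    lintegral_Ioi_rpow_div_one_add hb0 hb1, ENNReal.toReal_ofReal (by positivity)]
  filter_upwards [ae_restrict_mem measurableSet_Ioi] with t ht
  have : (0 : ℝ) < t := ht
  simp only [Pi.zero_apply]
  positivity

theorem mul_rpow_div_one_add_mul {b q t : ℝ} (hq : 0 < q) (ht : 0 < t) :
    t ^ (-b) * (q / (1 + q * t)) = q ^ b * (q * ((q * t) ^ (-b) / (1 + q * t))) := by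
  rw [Real.mul_rpow hq.le ht.le, Real.rpow_neg hq.le]
  have : 0 < q ^ b := Real.rpow_pos_of_pos hq b
  field_simp

/-- The two terms are integrable separately; rescaling `t` by `q` shows that the second contributes
`q^b` times the first. -/
theorem lintegral_Ioi_rpow_mul_sub {b q : ℝ} (hb0 : 0 < b) (hb1 : b < 1) (hq0 : 0 < q)
    (hq1 : q < 1) :
    ∫⁻ t in Set.Ioi (0 : ℝ), ENNReal.ofReal (t ^ (-b) * (1 / (1 + t) - q / (1 + q * t))) =
      ENNReal.ofReal (Real.pi / Real.sin (Real.pi * b) * (1 - q ^ b)) := by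
  have hint := integrableOn_Ioi_rpow_div_one_add hb0 hb1
  have hint2 : IntegrableOn (fun t : ℝ => q ^ b * (q * ((q * t) ^ (-b) / (1 + q * t))))
      (Set.Ioi 0) := by
    have := (integrableOn_Ioi_comp_mul_left_iff (fun t : ℝ => t ^ (-b) / (1 + t)) 0 hq0).2
      (by simpa using hint)
    exact (this.const_mul q).const_mul _
  have hval : ∫ t in Set.Ioi (0 : ℝ), q ^ b * (q * ((q * t) ^ (-b) / (1 + q * t))) =
      q ^ b * (Real.pi / Real.sin (Real.pi * b)) := by
    rw [integral_const_mul, integral_const_mul,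
      integral_comp_mul_left_Ioi (fun t : ℝ => t ^ (-b) / (1 + t)) 0 hq0, mul_zero,
      integral_Ioi_rpow_div_one_add hb0 hb1, smul_eq_mul, mul_inv_cancel_left₀ hq0.ne']
  have heq : ∀ t ∈ Set.Ioi (0 : ℝ), t ^ (-b) * (1 / (1 + t) - q / (1 + q * t)) =
      t ^ (-b) / (1 + t) - q ^ b * (q * ((q * t) ^ (-b) / (1 + q * t))) := by
    intro t ht
    rw [← mul_rpow_div_one_add_mul hq0 ht]
    ring
  have hint3 : IntegrableOn (fun t : ℝ => t ^ (-b) / (1 + t) -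
      q ^ b * (q * ((q * t) ^ (-b) / (1 + q * t)))) (Set.Ioi 0) := hint.sub hint2
  rw [setLIntegral_congr_fun measurableSet_Ioi
    (fun t ht => congrArg ENNReal.ofReal (heq t ht)), ← ofReal_integral_eq_lintegral_ofReal hint3]
  · rw [integral_sub hint hint2, hval, integral_Ioi_rpow_div_one_add hb0 hb1]
    congr 1; ring
  · filter_upwards [ae_restrict_mem measurableSet_Ioi] with t ht
    have ht' : (0 : ℝ) < t := ht
    simp only [Pi.zero_apply]
    rw [← heq t ht]
    refine mul_nonneg (by positivity) ?_
    rw [sub_nonneg, div_le_div_iff₀ (by positivity) (by positivity)]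
    nlinarith

/-- The logarithm of `1 - e^{-x}`. -/
noncomputable def logOneSubExpNeg (x : ℝ) : ℝ := Real.log (1 - Real.exp (-x))

@[fun_prop]
theorem measurable_logOneSubExpNeg : Measurable logOneSubExpNeg := by
  unfold logOneSubExpNeg; fun_prop

/-- The natural variable is `t = (e^x - 1) / (1 - e^{-(s-x)})`, in which the integrand is simply
`t^{-b}`. With `q = e^{-s}` its inverse is `x = log ((1+t)/(1+qt))`, mapping `(0, ∞)` onto `(0, s)`
with `dx = (1/(1+t) - q/(1+qt)) dt`. -/
theorem lintegral_Ioo_exp_logOneSubExpNeg {b s : ℝ} (hb0 : 0 < b) (hb1 : b < 1) (hs : 0 < s) :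
    ∫⁻ x in Set.Ioo 0 s, ENNReal.ofReal
      (Real.exp (-b * (x + logOneSubExpNeg x) + b * logOneSubExpNeg (s - x))) =
      ENNReal.ofReal (Real.pi / Real.sin (Real.pi * b) * (1 - Real.exp (-b * s))) := by
  set q := Real.exp (-s) with hq
  have hq0 : 0 < q := Real.exp_pos _
  have hq1 : q < 1 := by rw [hq, Real.exp_lt_one_iff]; linarith
  have hqs : q * Real.exp s = 1 := by rw [hq, ← Real.exp_add]; simp
  set ψ : ℝ → ℝ := fun t => Real.log ((1 + t) / (1 + q * t)) with hψ
  have hexp : ∀ t : ℝ, 0 < t → Real.exp (ψ t) = (1 + t) / (1 + q * t) := fun t ht =>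
    Real.exp_log (by positivity)
  have him : ψ '' Set.Ioi 0 = Set.Ioo 0 s := by
    ext x
    constructor
    · rintro ⟨t, ht, rfl⟩
      have ht' : 0 < t := ht
      constructor
      · rw [← Real.exp_lt_exp, hexp t ht', Real.exp_zero, lt_div_iff₀ (by positivity)]
        nlinarith
      · rw [← Real.exp_lt_exp, hexp t ht', div_lt_iff₀ (by positivity)]
        have : 1 < Real.exp s := Real.one_lt_exp_iff.2 hs
        nlinarith
    · rintro ⟨h0, h1⟩
      have h2 : 1 < Real.exp x := Real.one_lt_exp_iff.2 h0
      have h3 : q * Real.exp x < 1 := by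
        rw [← hqs]; exact mul_lt_mul_of_pos_left (Real.exp_lt_exp.2 h1) hq0
      have h4 : 0 < 1 - q * Real.exp x := by linarith
      refine ⟨(Real.exp x - 1) / (1 - q * Real.exp x), div_pos (by linarith) h4, ?_⟩
      rw [hψ]
      simp only
      rw [show (1 + (Real.exp x - 1) / (1 - q * Real.exp x)) /
        (1 + q * ((Real.exp x - 1) / (1 - q * Real.exp x))) = Real.exp x from ?_, Real.log_exp]
      have h5 : 1 - q ≠ 0 := by linarith
      have h6 : 1 + q * ((Real.exp x - 1) / (1 - q * Real.exp x)) =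
        (1 - q) / (1 - q * Real.exp x) := by field_simp; ring
      have h7 : 1 + (Real.exp x - 1) / (1 - q * Real.exp x) =
        (1 - q) * Real.exp x / (1 - q * Real.exp x) := by
        rw [eq_div_iff h4.ne', add_mul, div_mul_cancel₀ _ h4.ne']; ring
      rw [h6, h7]
      field_simp
  have hinj : Set.InjOn ψ (Set.Ioi 0) := by
    intro x hx y hy h
    have hx' : 0 < x := hx
    have hy' : 0 < y := hy
    have := congrArg Real.exp h
    rw [hexp x hx', hexp y hy', div_eq_div_iff (by positivity) (by positivity)] at this
    have h2 : (1 - q) * (x - y) = 0 := by linarith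
    rcases mul_eq_zero.1 h2 with h3 | h3 <;> linarith
  have hqb : q ^ b = Real.exp (-b * s) := by
    rw [hq, ← Real.exp_mul]; ring_nf
  rw [← him, lintegral_image_eq_lintegral_abs_deriv_mul
    (f' := fun t => 1 / (1 + t) - q / (1 + q * t)) measurableSet_Ioi _ hinj, ← hqb,
    ← lintegral_Ioi_rpow_mul_sub hb0 hb1 hq0 hq1]
  · refine setLIntegral_congr_fun measurableSet_Ioi ?_
    intro t ht
    have ht' : 0 < t := ht
    have hq2 : 0 < 1 - q := by linarith
    simp only
    have e1 : ψ t + logOneSubExpNeg (ψ t) = Real.log t + logOneSubExpNeg (s - ψ t) := by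
      have e2 : 1 - Real.exp (-ψ t) = (1 - q) * t / (1 + t) := by
        rw [Real.exp_neg, hexp t ht']; field_simp; ring
      have e3 : 1 - Real.exp (-(s - ψ t)) = (1 - q) / (1 + q * t) := by
        rw [neg_sub, sub_eq_add_neg (ψ t) s, Real.exp_add, hexp t ht', ← hq]; field_simp; ring
      rw [logOneSubExpNeg, logOneSubExpNeg, e2, e3, hψ,
        ← Real.log_mul (by positivity) (by positivity),
        ← Real.log_mul (by positivity) (by positivity)]
      congr 1
      field_simp
    rw [e1, show -b * (Real.log t + logOneSubExpNeg (s - ψ t)) + b * logOneSubExpNeg (s - ψ t) =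
      Real.log t * -b by ring, ← Real.rpow_def_of_pos ht', ← ENNReal.ofReal_mul (abs_nonneg _),
      abs_of_nonneg, mul_comm]
    rw [sub_nonneg, div_le_div_iff₀ (by positivity) (by positivity)]
    nlinarith
  · intro t ht
    have ht' : 0 < t := ht
    have h1 : HasDerivAt (fun t : ℝ => (1 + t) / (1 + q * t)) _ t :=
      ((hasDerivAt_id t).const_add 1).div (((hasDerivAt_id t).const_mul q).const_add 1)
      (by positivity)
    refine ((h1.log (by positivity)).congr_deriv ?_).hasDerivWithinAt
    field_simp
    simp

/-! ### Kernels on the half-line and their convolutions -/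

/-- The `ℝ≥0∞`-valued function supported on `(0, ∞)` given there by `h`. -/
noncomputable def halfLine (h : ℝ → ℝ) : ℝ → ℝ≥0∞ :=
  (Set.Ioi 0).indicator fun x => ENNReal.ofReal (h x)

theorem halfLine_of_pos (h : ℝ → ℝ) {x : ℝ} (hx : 0 < x) :
    halfLine h x = ENNReal.ofReal (h x) :=
  Set.indicator_of_mem (Set.mem_Ioi.2 hx) _

theorem halfLine_of_nonpos (h : ℝ → ℝ) {x : ℝ} (hx : x ≤ 0) : halfLine h x = 0 :=
  Set.indicator_of_notMem (Set.notMem_Ioi.2 hx) _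

theorem measurable_halfLine {h : ℝ → ℝ} (hh : Measurable h) : Measurable (halfLine h) :=
  hh.ennreal_ofReal.indicator measurableSet_Ioi

theorem halfLine_lconvolution_halfLine (f g : ℝ → ℝ) (s : ℝ) :
    (halfLine f ⋆ₗ halfLine g) s =
      ∫⁻ x in Set.Ioo 0 s, ENNReal.ofReal (f x) * ENNReal.ofReal (g (s - x)) := by
  rw [lconvolution_def, ← lintegral_indicator measurableSet_Ioo]
  refine lintegral_congr fun x => ?_
  rw [neg_add_eq_sub]
  by_cases hx : x ∈ Set.Ioo 0 s
  · rw [Set.indicator_of_mem hx, halfLine_of_pos _ hx.1, halfLine_of_pos _ (sub_pos.2 hx.2)]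
  · rw [Set.indicator_of_notMem hx]
    by_cases h0 : 0 < x
    · rw [halfLine_of_nonpos g, mul_zero]
      exact sub_nonpos.2 (not_lt.1 fun h => hx ⟨h0, h⟩)
    · rw [halfLine_of_nonpos f (not_lt.1 h0), zero_mul]

theorem halfLine_lconvolution_of_nonpos (f g : ℝ → ℝ) {s : ℝ} (hs : s ≤ 0) :
    (halfLine f ⋆ₗ halfLine g) s = 0 := by
  rw [halfLine_lconvolution_halfLine, Set.Ioo_eq_empty (not_lt.2 hs)]; simp

theorem halfLine_lconvolution_halfLine_of_continuous {f g : ℝ → ℝ} (hf : Continuous f)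
    (hg : Continuous g) (hf0 : ∀ x, 0 ≤ x → 0 ≤ f x) (hg0 : ∀ x, 0 ≤ x → 0 ≤ g x) :
    halfLine f ⋆ₗ halfLine g = halfLine fun s => ∫ x in 0..s, f x * g (s - x) := by
  ext s
  rcases le_or_gt s 0 with hs | hs
  · rw [halfLine_of_nonpos _ hs, halfLine_lconvolution_of_nonpos _ _ hs]
  · rw [halfLine_of_pos _ hs, halfLine_lconvolution_halfLine,
      intervalIntegral.integral_of_le hs.le, integral_Ioc_eq_integral_Ioo,
      ofReal_integral_eq_lintegral_ofReal]
    · refine setLIntegral_congr_fun measurableSet_Ioo fun x hx => ?_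
      exact (ENNReal.ofReal_mul (hf0 x hx.1.le)).symm
    · have hc : Continuous fun x => f x * g (s - x) := by fun_prop
      exact (hc.continuousOn.integrableOn_compact isCompact_Icc).mono_set Set.Ioo_subset_Icc_self
    · filter_upwards [ae_restrict_mem measurableSet_Ioo] with x hx
      exact mul_nonneg (hf0 x hx.1.le) (hg0 _ (sub_pos.2 hx.2).le)

/-- The exponential `e^{ax}` on `(0, ∞)`. -/
noncomputable def expKernel (a : ℝ) : ℝ → ℝ≥0∞ := halfLine fun x => Real.exp (a * x)

/-- The factor of `e^{a (d₁ - d_ℓ)}` depending on the first coordinate. -/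
noncomputable def firstKernel (a : ℝ) : ℝ → ℝ≥0∞ :=
  halfLine fun x => Real.exp (a * (x + logOneSubExpNeg x))

/-- The factor of `e^{a (d₁ - d_ℓ)}` depending on the `ℓ`-th coordinate. -/
noncomputable def lastKernel (a : ℝ) : ℝ → ℝ≥0∞ :=
  halfLine fun x => Real.exp (-a * logOneSubExpNeg x)

theorem measurable_expKernel (a : ℝ) : Measurable (expKernel a) :=
  measurable_halfLine (by fun_prop)

theorem measurable_firstKernel (a : ℝ) : Measurable (firstKernel a) :=
  measurable_halfLine (by fun_prop)

theorem measurable_lastKernel (a : ℝ) : Measurable (lastKernel a) :=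
  measurable_halfLine (by fun_prop)

theorem expKernel_lconvolution_expKernel_zero (a s : ℝ) :
    (expKernel a ⋆ₗ expKernel 0) s = halfLine (fun s => ∫ x in 0..s, Real.exp (a * x)) s := by
  rw [expKernel, expKernel, halfLine_lconvolution_halfLine_of_continuous (by fun_prop)
    (by fun_prop) (fun _ _ => (Real.exp_pos _).le) (fun _ _ => (Real.exp_pos _).le)]
  simp

/-- The reflection `x ↦ s - x`, in the form of commutativity of convolution. It reduces `u > 0` to
`u < 0`, where the exponent `b = -2u` of the Beta integral lies in `(0, 1)`. -/
theorem firstKernel_lconvolution_lastKernel_reflect (a s : ℝ) :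
    (firstKernel a ⋆ₗ lastKernel a) s =
      ENNReal.ofReal (Real.exp (a * s)) * (firstKernel (-a) ⋆ₗ lastKernel (-a)) s := by
  rw [lconvolution_comm (f := firstKernel (-a))]
  simp only [firstKernel, lastKernel, halfLine_lconvolution_halfLine]
  rw [← lintegral_const_mul' _ _ ENNReal.ofReal_ne_top]
  refine lintegral_congr fun x => ?_
  simp only [← ENNReal.ofReal_mul (Real.exp_pos _).le, ← Real.exp_add]
  ring_nf

theorem expKernel_lconvolution_reflect (a s : ℝ) :
    (expKernel a ⋆ₗ expKernel 0) s =
      ENNReal.ofReal (Real.exp (a * s)) * (expKernel (-a) ⋆ₗ expKernel 0) s := by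
  rw [lconvolution_comm (f := expKernel (-a))]
  simp only [expKernel, halfLine_lconvolution_halfLine]
  rw [← lintegral_const_mul' _ _ ENNReal.ofReal_ne_top]
  refine lintegral_congr fun x => ?_
  simp only [← ENNReal.ofReal_mul (Real.exp_pos _).le, ← Real.exp_add]
  ring_nf

theorem sinePrefactor_neg (u : ℝ) : sinePrefactor (-u) = sinePrefactor u := by
  simp [sinePrefactor, Real.sin_neg]

theorem sinePrefactor_nonneg {u : ℝ} (hu : |u| < 1 / 2) : 0 ≤ sinePrefactor u := by
  wlog h : 0 ≤ u generalizing u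
  · rw [← sinePrefactor_neg]
    exact this (by rwa [abs_neg]) (by linarith)
  unfold sinePrefactor
  split_ifs
  · exact zero_le_one
  · have := (abs_lt.1 hu).2
    exact div_nonneg (by positivity)
      (Real.sin_nonneg_of_nonneg_of_le_pi (by positivity) (by nlinarith [Real.pi_pos]))

theorem firstKernel_lconvolution_lastKernel_of_neg {u : ℝ} (hu : |u| < 1 / 2) (h0 : u < 0) :
    firstKernel (2 * u) ⋆ₗ lastKernel (2 * u) =
      ENNReal.ofReal (sinePrefactor u) • (expKernel (2 * u) ⋆ₗ expKernel 0) := by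
  ext s
  rw [Pi.smul_apply, expKernel_lconvolution_expKernel_zero]
  rcases le_or_gt s 0 with hs | hs
  · rw [firstKernel, lastKernel, halfLine_lconvolution_of_nonpos _ _ hs,
      halfLine_of_nonpos _ hs, smul_zero]
  · have h1 := (abs_lt.1 hu).1
    have key := lintegral_Ioo_exp_logOneSubExpNeg (b := -(2 * u)) (by linarith) (by linarith) hs
    rw [firstKernel, lastKernel, halfLine_lconvolution_halfLine, halfLine_of_pos _ hs,
      smul_eq_mul, ← ENNReal.ofReal_mul (sinePrefactor_nonneg hu)]
    simp only [← ENNReal.ofReal_mul (Real.exp_pos _).le, ← Real.exp_add]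
    simp only [neg_neg] at key
    rw [key, sinePrefactor, if_neg h0.ne,
      intervalIntegral.integral_comp_mul_left _ (by simp [h0.ne]), integral_exp, mul_neg,
      Real.sin_neg, mul_zero, Real.exp_zero, smul_eq_mul,
      show Real.pi * (2 * u) = 2 * Real.pi * u by ring]
    congr 1
    have : u ≠ 0 := h0.ne
    field_simp
    ring

/-- Convolving the two singular kernels yields, up to the sine prefactor, exponential kernels. -/
theorem firstKernel_lconvolution_lastKernel {u : ℝ} (hu : |u| < 1 / 2) :
    firstKernel (2 * u) ⋆ₗ lastKernel (2 * u) =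
      ENNReal.ofReal (sinePrefactor u) • (expKernel (2 * u) ⋆ₗ expKernel 0) := by
  rcases lt_trichotomy u 0 with h | rfl | h
  · exact firstKernel_lconvolution_lastKernel_of_neg hu h
  · simp [firstKernel, lastKernel, expKernel, sinePrefactor]
  · ext s
    have := congrFun (firstKernel_lconvolution_lastKernel_of_neg (u := -u) (by rwa [abs_neg])
      (by linarith)) s
    rw [firstKernel_lconvolution_lastKernel_reflect, ← mul_neg, this, Pi.smul_apply, Pi.smul_apply,
      sinePrefactor_neg, expKernel_lconvolution_reflect (2 * u), smul_eq_mul, smul_eq_mul,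
      mul_left_comm, mul_neg]

/-! ### Iterated convolutions with exponential kernels -/

/-- The iterated convolution of `g` with `i` copies of `expKernel a` and `j` copies of
`expKernel 0`. -/
noncomputable def kernelIterate (a : ℝ) (i j : ℕ) (g : ℝ → ℝ≥0∞) : ℝ → ℝ≥0∞ :=
  (fun g => expKernel a ⋆ₗ g)^[i] ((fun g => expKernel 0 ⋆ₗ g)^[j] g)

theorem measurable_lconvolution_iterate {k g : ℝ → ℝ≥0∞} (hk : Measurable k) (hg : Measurable g)
    (n : ℕ) : Measurable ((fun g => k ⋆ₗ g)^[n] g) := by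
  induction n with
  | zero => exact hg
  | succ n ih =>
    rw [Function.iterate_succ_apply']
    exact measurable_lconvolution _ hk ih

theorem lconvolution_iterate_comm {f k g : ℝ → ℝ≥0∞} (hf : Measurable f) (hk : Measurable k)
    (hg : Measurable g) (n : ℕ) :
    f ⋆ₗ (fun g => k ⋆ₗ g)^[n] g = (fun g => k ⋆ₗ g)^[n] (f ⋆ₗ g) := by
  induction n with
  | zero => rfl
  | succ n ih =>
    have hm := measurable_lconvolution_iterate hk hg n
    rw [Function.iterate_succ_apply', Function.iterate_succ_apply', ← ih,
      lconvolution_assoc hf hk hm, lconvolution_assoc hk hf hm, lconvolution_comm (f := f)]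

/-- This brings the kernel of the first coordinate next to that of the `ℓ`-th, past the exponentials
in between. -/
theorem lconvolution_kernelIterate {f g : ℝ → ℝ≥0∞} (hf : Measurable f) (hg : Measurable g)
    (a : ℝ) (i j : ℕ) : f ⋆ₗ kernelIterate a i j g = kernelIterate a i j (f ⋆ₗ g) := by
  unfold kernelIterate
  rw [lconvolution_iterate_comm hf (measurable_expKernel a)
    (measurable_lconvolution_iterate (measurable_expKernel 0) hg j),
    lconvolution_iterate_comm hf (measurable_expKernel 0) hg]

theorem kernelIterate_smul {c : ℝ≥0∞} (hc : c ≠ ∞) (a : ℝ) (i j : ℕ) (g : ℝ → ℝ≥0∞) :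
    kernelIterate a i j (c • g) = c • kernelIterate a i j g := by
  have h (k : ℝ → ℝ≥0∞) (n : ℕ) (g : ℝ → ℝ≥0∞) :
      (fun g => k ⋆ₗ g)^[n] (c • g) = c • (fun g => k ⋆ₗ g)^[n] g := by
    induction n with
    | zero => rfl
    | succ n ih =>
      rw [Function.iterate_succ_apply', Function.iterate_succ_apply', ih]
      ext s
      simp only [lconvolution_def, Pi.smul_apply, smul_eq_mul]
      rw [← lintegral_const_mul' _ _ hc]
      exact lintegral_congr fun x => mul_left_comm _ _ _
  rw [kernelIterate, h, h, kernelIterate]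

/-- The product `e^{ax} e^{a(s-x)}` does not depend on `x`, so only the iterated integral of `1`
remains. -/
theorem expKernel_lconvolution_iterate_self (a : ℝ) (i : ℕ) :
    (fun g => expKernel a ⋆ₗ g)^[i] (expKernel a) =
      halfLine fun x => Real.exp (a * x) * x ^ i / i ! := by
  induction i with
  | zero => simp [expKernel]
  | succ i ih =>
    rw [Function.iterate_succ_apply', ih, expKernel,
      halfLine_lconvolution_halfLine_of_continuous (by fun_prop) (by fun_prop)
        (fun _ _ => (Real.exp_pos _).le) (fun x hx => by positivity)]
    congr 1
    ext s
    have h : ∀ x : ℝ, Real.exp (a * x) * (Real.exp (a * (s - x)) * (s - x) ^ i / i !) =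
        Real.exp (a * s) / i ! * (s - x) ^ i := by
      intro x
      rw [show Real.exp (a * s) = Real.exp (a * x) * Real.exp (a * (s - x)) by
        rw [← Real.exp_add]; ring_nf]
      ring
    simp only [h]
    rw [intervalIntegral.integral_const_mul,
      intervalIntegral.integral_comp_sub_left (fun t => t ^ i), integral_pow, Nat.factorial_succ]
    have := Nat.factorial_ne_zero i
    push_cast
    field_simp
    simp

/-- The integral of `e^{ax}` against the law of a partial sum of coordinates on a simplex of
total `y`. -/
noncomputable def simplexExpIntegral (i j : ℕ) (a y : ℝ) : ℝ :=
  ∫ x in 0..y, Real.exp (a * x) * x ^ i / i ! * ((y - x) ^ j / j !)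

theorem kernelIterate_expKernel (a : ℝ) (i j : ℕ) :
    kernelIterate a i j (expKernel a ⋆ₗ expKernel 0) = halfLine (simplexExpIntegral i j a) := by
  have h0 := measurable_expKernel 0
  have ha := measurable_expKernel a
  have hm := measurable_lconvolution_iterate h0 h0 j
  -- Regroup into `i + 1` copies of `expKernel a` convolved with `j + 1` copies of `expKernel 0`.
  rw [kernelIterate, ← lconvolution_iterate_comm ha h0 h0, lconvolution_comm (f := expKernel a),
    ← lconvolution_iterate_comm hm ha ha, lconvolution_comm,
    expKernel_lconvolution_iterate_self, expKernel_lconvolution_iterate_self,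
    halfLine_lconvolution_halfLine_of_continuous (by fun_prop) (by fun_prop)
      (fun x hx => by positivity) (fun x hx => by positivity)]
  simp
  rfl

/-! ### Integrals of products over a simplex as convolutions -/

theorem measurableSet_openSimplex (m : ℕ) (y : ℝ) : MeasurableSet (openSimplex m y) := by
  have h : openSimplex m y = (⋂ i, {x | 0 < x i}) ∩ {x | ∑ i, x i = y} := by
    ext; simp [openSimplex]
  rw [h]
  exact (MeasurableSet.iInter fun i => measurableSet_lt measurable_const
    (measurable_pi_apply i)).inter (measurableSet_eq_fun (by fun_prop) measurable_const)

instance (m : ℕ) (y : ℝ) : SFinite (simplexMeasure m y) := by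
  unfold simplexMeasure; infer_instance

theorem ae_simplexMeasure_pos (m : ℕ) (y : ℝ) : ∀ᵐ w ∂simplexMeasure m y, ∀ i, 0 < w i := by
  have h : ∀ᵐ w ∂simplexMeasure m y, w ∈ openSimplex m y := by
    refine (ae_map_iff (measurable_simplexChart m y).aemeasurable
      (measurableSet_openSimplex m y)).2 ?_
    exact ae_restrict_mem (measurable_simplexChart m y (measurableSet_openSimplex m y))
  exact h.mono fun w hw => hw.1

theorem lintegral_simplexMeasure (m : ℕ) (y : ℝ) {F : (Fin (m + 1) → ℝ) → ℝ≥0∞}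
    (hF : Measurable F) :
    ∫⁻ w, F w ∂simplexMeasure m y =
      ∫⁻ x, (openSimplex m y).indicator F (simplexChart m y x) := by
  have hs := measurable_simplexChart m y (measurableSet_openSimplex m y)
  rw [simplexMeasure, lintegral_map hF (measurable_simplexChart m y)]
  exact (lintegral_indicator hs _).symm

theorem simplexChart_cons (m : ℕ) (y x : ℝ) (v : Fin m → ℝ) :
    simplexChart (m + 1) y (Fin.cons x v) = Fin.cons x (simplexChart m (y - x) v) := by
  rw [simplexChart, simplexChart, Fin.cons_snoc_eq_snoc_cons, Fin.sum_cons, sub_sub]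

theorem cons_mem_openSimplex {m : ℕ} {y x : ℝ} {w : Fin (m + 1) → ℝ} :
    (Fin.cons x w : Fin (m + 2) → ℝ) ∈ openSimplex (m + 1) y ↔
      0 < x ∧ w ∈ openSimplex m (y - x) := by
  simp only [openSimplex, Set.mem_ofPred_eq, Fin.forall_fin_succ (n := m + 1), Fin.cons_zero,
    Fin.cons_succ, Fin.sum_cons, and_assoc, eq_sub_iff_add_eq']

/-- The measure is a unit mass at `y` if `y > 0` and zero otherwise, whence the condition `h0`. -/
theorem lintegral_simplexMeasure_zero (y : ℝ) {F : (Fin 1 → ℝ) → ℝ≥0∞} (hF : Measurable F)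
    (h0 : y ≤ 0 → F (fun _ => y) = 0) :
    ∫⁻ w, F w ∂simplexMeasure 0 y = F fun _ => y := by
  have hc : ∀ x : Fin 0 → ℝ, simplexChart 0 y x = fun _ => y := by
    intro x; ext i; fin_cases i; simp [simplexChart, Fin.snoc]
  rw [lintegral_simplexMeasure 0 y hF]
  rw [Measure.volume_pi_eq_dirac 0, lintegral_dirac, hc]
  by_cases hy : 0 < y
  · have : (fun _ => y) ∈ openSimplex 0 y := ⟨fun _ => hy, by simp⟩
    exact Set.indicator_of_mem this _
  · have : (fun _ => y) ∉ openSimplex 0 y := fun h => hy (h.1 0)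
    rw [h0 (not_lt.1 hy)]
    exact Set.indicator_of_notMem this _

/-- Tonelli: the slice of the simplex at first coordinate `x` is a simplex of total `y - x`, empty
once `x ≥ y`, so no upper limit on `x` is needed. -/
theorem lintegral_simplexMeasure_succ (m : ℕ) (y : ℝ) {F : (Fin (m + 2) → ℝ) → ℝ≥0∞}
    (hF : Measurable F) :
    ∫⁻ w, F w ∂simplexMeasure (m + 1) y =
      ∫⁻ x in Set.Ioi 0, ∫⁻ w, F (Fin.cons x w) ∂simplexMeasure m (y - x) := by
  have hmeas : Measurable fun x => (openSimplex (m + 1) y).indicator F (simplexChart (m + 1) y x) :=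
    (hF.indicator (measurableSet_openSimplex _ _)).comp (measurable_simplexChart _ _)
  have hmp := (volume_preserving_piFinSuccAbove (fun _ : Fin (m + 1) => ℝ) 0).symm
  have hcomp : Measurable fun q : ℝ × (Fin m → ℝ) => (openSimplex (m + 1) y).indicator F
      (simplexChart (m + 1) y ((MeasurableEquiv.piFinSuccAbove (fun _ => ℝ) 0).symm q)) :=
    hmeas.comp hmp.measurable
  have hins (x : ℝ) (v : Fin m → ℝ) :
      (MeasurableEquiv.piFinSuccAbove (fun _ => ℝ) 0).symm (x, v) = (Fin.cons x v : Fin (m + 1) → ℝ) :=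
    Fin.insertNth_zero' x v
  have hcons : Measurable fun q : ℝ × (Fin (m + 1) → ℝ) => (Fin.cons q.1 q.2 : Fin (m + 2) → ℝ) :=
    measurable_pi_lambda _ fun i => by
      refine Fin.cases ?_ (fun j => ?_) i <;> simp only [Fin.cons_zero, Fin.cons_succ] <;> fun_prop
  rw [lintegral_simplexMeasure _ _ hF, ← hmp.lintegral_comp hmeas, Measure.volume_eq_prod,
    lintegral_prod _ hcomp.aemeasurable,
    ← lintegral_indicator measurableSet_Ioi]
  refine lintegral_congr fun x => ?_
  have hx : Measurable fun w : Fin (m + 1) → ℝ => F (Fin.cons x w) :=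
    hF.comp (hcons.comp measurable_prodMk_left)
  by_cases h : 0 < x
  · rw [Set.indicator_of_mem (Set.mem_Ioi.2 h), lintegral_simplexMeasure m _ hx]
    refine lintegral_congr fun v => ?_
    rw [hins, simplexChart_cons]
    by_cases hv : simplexChart m (y - x) v ∈ openSimplex m (y - x)
    · rw [Set.indicator_of_mem hv, Set.indicator_of_mem (cons_mem_openSimplex.2 ⟨h, hv⟩)]
    · rw [Set.indicator_of_notMem hv,
        Set.indicator_of_notMem fun h => hv (cons_mem_openSimplex.1 h).2]
  · rw [Set.indicator_of_notMem (by simpa using h)]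
    refine (lintegral_congr fun v => ?_).trans lintegral_zero
    rw [hins, simplexChart_cons]
    exact Set.indicator_of_notMem (fun h' => h (cons_mem_openSimplex.1 h').1) _

theorem measurable_prod_apply {n : ℕ} {f : Fin n → ℝ → ℝ≥0∞} (hf : ∀ i, Measurable (f i)) :
    Measurable fun w : Fin n → ℝ => ∏ i, f i (w i) :=
  Finset.measurable_prod _ fun i _ => (hf i).comp (measurable_pi_apply i)

theorem lintegral_simplexMeasure_prod_succ (m : ℕ) (y : ℝ) {f : ℕ → ℝ → ℝ≥0∞}
    (hf : ∀ i, Measurable (f i)) (h0 : ∀ x ≤ 0, f 0 x = 0) :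
    ∫⁻ w, ∏ i : Fin (m + 2), f i (w i) ∂simplexMeasure (m + 1) y =
      (f 0 ⋆ₗ fun y => ∫⁻ w, ∏ i : Fin (m + 1), f (i + 1) (w i) ∂simplexMeasure m y) y := by
  rw [lintegral_simplexMeasure_succ m y (measurable_prod_apply fun i => hf i), lconvolution_def,
    ← lintegral_indicator measurableSet_Ioi]
  refine lintegral_congr fun x => ?_
  by_cases h : 0 < x
  · rw [Set.indicator_of_mem (Set.mem_Ioi.2 h), neg_add_eq_sub, ← lintegral_const_mul _
      (measurable_prod_apply fun i : Fin (m + 1) => hf (i + 1))]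
    refine lintegral_congr fun w => ?_
    simp [Fin.prod_univ_succ (n := m + 1)]
  · rw [Set.indicator_of_notMem (by simpa using h), h0 x (not_lt.1 h), zero_mul]

/-- The sequence of kernels consisting of `n` copies of `expKernel a`, then `g`, then copies of
`expKernel 0`. -/
noncomputable def kernelSeq (a : ℝ) (n : ℕ) (g : ℝ → ℝ≥0∞) (i : ℕ) : ℝ → ℝ≥0∞ :=
  if i < n then expKernel a else if i = n then g else expKernel 0

theorem measurable_kernelSeq (a : ℝ) (n : ℕ) {g : ℝ → ℝ≥0∞} (hg : Measurable g) (i : ℕ) :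
    Measurable (kernelSeq a n g i) := by
  unfold kernelSeq
  split_ifs
  exacts [measurable_expKernel a, hg, measurable_expKernel 0]

theorem kernelSeq_of_nonpos (a : ℝ) (n : ℕ) {g : ℝ → ℝ≥0∞} (hg : ∀ x ≤ 0, g x = 0) (i : ℕ)
    {x : ℝ} (hx : x ≤ 0) : kernelSeq a n g i x = 0 := by
  unfold kernelSeq
  split_ifs
  exacts [halfLine_of_nonpos _ hx, hg x hx, halfLine_of_nonpos _ hx]

theorem kernelSeq_succ_succ (a : ℝ) (n : ℕ) (g : ℝ → ℝ≥0∞) (i : ℕ) :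
    kernelSeq a (n + 1) g (i + 1) = kernelSeq a n g i := by
  simp [kernelSeq]

/-- Once `g` is peeled off, the constant tail again has the shape of `kernelSeq`, so the induction
on `j` can continue with `g` replaced by `expKernel 0`. -/
theorem kernelSeq_zero_succ (a : ℝ) (g : ℝ → ℝ≥0∞) (i : ℕ) :
    kernelSeq a 0 g (i + 1) = kernelSeq a 0 (expKernel 0) i := by
  simp [kernelSeq]

theorem lintegral_simplexMeasure_prod_kernelSeq (a : ℝ) (n j : ℕ) {g : ℝ → ℝ≥0∞}
    (hg : Measurable g) (hg0 : ∀ x ≤ 0, g x = 0) (y : ℝ) :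
    ∫⁻ w, ∏ i : Fin (n + j + 1), kernelSeq a n g i (w i) ∂simplexMeasure (n + j) y =
      kernelIterate a n j g y := by
  induction n generalizing j g y with
  | zero =>
    induction j generalizing g y with
    | zero =>
      rw [lintegral_simplexMeasure_zero y
        (measurable_prod_apply fun i => measurable_kernelSeq a 0 hg i)]
      · simp [kernelSeq, kernelIterate]
      · intro hy; simp [kernelSeq, hg0 y hy]
    | succ j ih =>
      have h1 : Measurable (expKernel 0) := measurable_expKernel 0
      refine (lintegral_simplexMeasure_prod_succ (0 + j) y (fun i => measurable_kernelSeq a 0 hg i)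
        fun x hx => kernelSeq_of_nonpos a 0 hg0 0 hx).trans ?_
      simp only [kernelSeq_zero_succ]
      simp only [ih h1 (fun x hx => halfLine_of_nonpos _ hx)]
      change (g ⋆ₗ kernelIterate a 0 j (expKernel 0)) y = _
      rw [lconvolution_kernelIterate hg h1, lconvolution_comm]
      rfl
  | succ n ih =>
    rw [show n + 1 + j = n + j + 1 by ring]
    refine (lintegral_simplexMeasure_prod_succ (n + j) y
      (fun i => measurable_kernelSeq a (n + 1) hg i)
      fun x hx => kernelSeq_of_nonpos a (n + 1) hg0 0 hx).trans ?_
    simp only [kernelSeq_succ_succ]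
    simp only [ih j hg hg0]
    change (expKernel a ⋆ₗ kernelIterate a n j g) y = _
    simp only [kernelIterate, Function.iterate_succ_apply']

/-- The sequence of kernels beginning with `f` and continuing with `kernelSeq`. -/
noncomputable def kernelSeqCons (a : ℝ) (n : ℕ) (f g : ℝ → ℝ≥0∞) : ℕ → ℝ → ℝ≥0∞
  | 0 => f
  | i + 1 => kernelSeq a n g i

theorem measurable_kernelSeqCons (a : ℝ) (n : ℕ) {f g : ℝ → ℝ≥0∞} (hf : Measurable f)
    (hg : Measurable g) (i : ℕ) : Measurable (kernelSeqCons a n f g i) := by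
  cases i
  exacts [hf, measurable_kernelSeq a n hg _]

theorem lintegral_simplexMeasure_prod_kernelSeqCons (a : ℝ) (n j : ℕ) {f g : ℝ → ℝ≥0∞}
    (hf : Measurable f) (hf0 : ∀ x ≤ 0, f x = 0) (hg : Measurable g) (hg0 : ∀ x ≤ 0, g x = 0)
    (y : ℝ) :
    ∫⁻ w, ∏ i : Fin (n + j + 2), kernelSeqCons a n f g i (w i) ∂simplexMeasure (n + j + 1) y =
      kernelIterate a n j (f ⋆ₗ g) y := by
  refine (lintegral_simplexMeasure_prod_succ (n + j) y
    (measurable_kernelSeqCons a n hf hg) hf0).trans ?_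
  simp only [kernelSeqCons, lintegral_simplexMeasure_prod_kernelSeq a n j hg hg0]
  rw [← lconvolution_kernelIterate hf hg]

theorem prod_kernelSeqCons_eq_ofReal_exp (a : ℝ) {n m : ℕ} (hn : n ≤ m) (x : ℕ → ℝ)
    {F G : ℝ → ℝ} (hx : ∀ i, i < m + 2 → 0 < x i) :
    ∏ i : Fin (m + 2), kernelSeqCons a n (halfLine fun x => Real.exp (F x))
      (halfLine fun x => Real.exp (G x)) i (x i) =
    ENNReal.ofReal (Real.exp
      (F (x 0) + a * ∑ t ∈ Finset.range n, x (t + 1) + G (x (n + 1)))) := by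
  have h : ∀ i : Fin (m + 1), kernelSeq a n (halfLine fun x => Real.exp (G x)) i (x (i + 1)) =
      ENNReal.ofReal (Real.exp
        ((if (i : ℕ) < n then a * x (i + 1) else 0) + if (i : ℕ) = n then G (x (i + 1)) else 0)) := by
    intro i
    have hi : 0 < x (i + 1) := hx _ (by omega)
    unfold kernelSeq
    split_ifs with h1 h2 h2
    · omega
    · rw [expKernel, halfLine_of_pos _ hi, add_zero]
    · rw [halfLine_of_pos _ hi, zero_add]
    · rw [expKernel, halfLine_of_pos _ hi, zero_mul, add_zero]
  rw [Fin.prod_univ_succ]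
  simp only [Fin.val_zero, Fin.val_succ, kernelSeqCons, h]
  rw [halfLine_of_pos _ (hx 0 (by omega)),
    ← ENNReal.ofReal_prod_of_nonneg fun i _ => (Real.exp_pos _).le, ← Real.exp_sum,
    ← ENNReal.ofReal_mul (Real.exp_pos _).le, ← Real.exp_add, Finset.sum_add_distrib,
    Fin.sum_univ_eq_sum_range (fun i => if i < n then a * x (i + 1) else 0),
    Fin.sum_univ_eq_sum_range (fun i => if i = n then G (x (i + 1)) else 0),
    Finset.sum_ite_eq', if_pos (Finset.mem_range.2 (by omega)), ← Finset.sum_filter,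
    Finset.mul_sum, add_assoc]
  congr 4
  refine Finset.sum_congr ?_ fun _ _ => rfl
  ext t
  simp only [Finset.mem_filter, Finset.mem_range]
  omega

/-! ### Telescoping of the edge distances and factorisation of the integrand -/

/-- Since `log (e^w - 1) = w + log (1 - e^{-w})`, the term `w_{j+1}` cancels and the logarithms form
a telescoping difference. -/
theorem neg_edgeDistStep {m : ℕ} {w v : Fin (m + 1) → ℝ} (hw : ∀ i, 0 < w i) (j : Fin m) :
    -edgeDistStep w v j = w j.castSucc - v j.castSucc +
      (logOneSubExpNeg (w j.castSucc) - logOneSubExpNeg (w j.succ)) := by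
  have h1 : Real.exp (-w j.castSucc) < 1 := by
    rw [Real.exp_lt_one_iff]; linarith [hw j.castSucc]
  have h2 : Real.exp (-w j.succ) < 1 := by rw [Real.exp_lt_one_iff]; linarith [hw j.succ]
  have h3 : Real.exp (w j.succ) - 1 = Real.exp (w j.succ) * (1 - Real.exp (-w j.succ)) := by
    rw [mul_sub, ← Real.exp_add]; simp
  rw [edgeDistStep, cornerShear, h3, Real.log_div (by linarith)
    (mul_ne_zero (Real.exp_pos _).ne' (by linarith)), Real.log_mul (Real.exp_pos _).ne'
    (by linarith), Real.log_exp, logOneSubExpNeg, logOneSubExpNeg]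
  ring

theorem edgeDistDiff_eq {m i : ℕ} (hi : i ≤ m) {x z : ℕ → ℝ}
    (hx : ∀ t, t < m + 2 → 0 < x t) :
    edgeDistDiff (i + 2) (fun t : Fin (m + 2) => x t) (fun t => z t) =
      ∑ t ∈ Finset.range (i + 1), (x t - z t) +
        (logOneSubExpNeg (x 0) - logOneSubExpNeg (x (i + 1))) := by
  rw [edgeDistDiff, ← Finset.sum_neg_distrib, Finset.sum_congr rfl
    fun j _ => neg_edgeDistStep (fun t : Fin (m + 2) => hx t t.2) j, Finset.sum_filter]
  simp only [Fin.val_castSucc, Fin.val_succ]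
  rw [Fin.sum_univ_eq_sum_range (fun j => if j + 1 < i + 2 then x j - z j +
    (logOneSubExpNeg (x j) - logOneSubExpNeg (x (j + 1))) else 0), ← Finset.sum_filter,
    show (Finset.range (m + 1)).filter (fun j => j + 1 < i + 2) = Finset.range (i + 1) by
      ext t; simp only [Finset.mem_filter, Finset.mem_range]; omega,
    Finset.sum_add_distrib, Finset.sum_range_sub' (fun t => logOneSubExpNeg (x t))]

theorem exists_nat_extension {n : ℕ} {w : Fin n → ℝ} :
    ∃ x : ℕ → ℝ, w = fun t : Fin n => x t :=
  ⟨fun t => if h : t < n then w ⟨t, h⟩ else 0, by ext t; simp⟩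

/-- Among the `w`-coordinates the first and the `ℓ`-th (`ℓ = i + 2`) carry the singular kernels,
with `i` exponentials between them. Among the `v`-coordinates the first `i + 1` carry `e^{-2ux}`.
All later coordinates carry the constant kernel. -/
theorem ofReal_boundaryIntegrand {m i : ℕ} (hi : i ≤ m) (u : ℝ) {w v : Fin (m + 2) → ℝ}
    (hw : ∀ t, 0 < w t) (hv : ∀ t, 0 < v t) :
    ENNReal.ofReal (boundaryIntegrand (m + 1) (i + 2) u (w, v)) =
      (∏ t : Fin (m + 2),
        kernelSeqCons (2 * u) i (firstKernel (2 * u)) (lastKernel (2 * u)) t (w t)) *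
      ∏ t : Fin (m + 2),
        kernelSeqCons (-(2 * u)) i (expKernel (-(2 * u))) (expKernel 0) t (v t) := by
  obtain ⟨x, rfl⟩ := exists_nat_extension (w := w)
  obtain ⟨z, rfl⟩ := exists_nat_extension (w := v)
  have hx : ∀ t, t < m + 2 → 0 < x t := fun t ht => hw ⟨t, ht⟩
  have hz : ∀ t, t < m + 2 → 0 < z t := fun t ht => hv ⟨t, ht⟩
  simp only [firstKernel, lastKernel, expKernel]
  rw [prod_kernelSeqCons_eq_ofReal_exp _ hi x hx,
    prod_kernelSeqCons_eq_ofReal_exp _ hi z hz, ← ENNReal.ofReal_mul (Real.exp_pos _).le,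
    ← Real.exp_add, boundaryIntegrand, edgeDistDiff_eq hi hx, Finset.sum_sub_distrib,
    Finset.sum_range_succ', Finset.sum_range_succ']
  congr 2
  ring

theorem measurable_boundaryIntegrand (m ℓ : ℕ) (u : ℝ) : Measurable (boundaryIntegrand m ℓ u) := by
  unfold boundaryIntegrand edgeDistDiff edgeDistStep cornerShear
  fun_prop

theorem boundaryIntegrand_nonneg (m ℓ : ℕ) (u : ℝ) : 0 ≤ boundaryIntegrand m ℓ u :=
  fun _ => (Real.exp_pos _).le

/-! ### Convergence and evaluation of `E_{k,ℓ}` -/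

theorem lintegral_boundaryIntegrand (i j : ℕ) {L u : ℝ} (hu : |u| < 1 / 2) :
    ∫⁻ q, ENNReal.ofReal (boundaryIntegrand (i + j + 1) (i + 2) u q)
      ∂((simplexMeasure (i + j + 1) (L / 2)).prod (simplexMeasure (i + j + 1) (L / 2))) =
    ENNReal.ofReal (sinePrefactor u) * halfLine (simplexExpIntegral i j (2 * u)) (L / 2) *
      halfLine (simplexExpIntegral i j (-(2 * u))) (L / 2) := by
  have hm1 := measurable_prod_apply (n := i + j + 2) fun t => measurable_kernelSeqCons (2 * u) i
    (measurable_firstKernel (2 * u)) (measurable_lastKernel (2 * u)) t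
  have hm2 := measurable_prod_apply (n := i + j + 2) fun t => measurable_kernelSeqCons (-(2 * u)) i
    (measurable_expKernel (-(2 * u))) (measurable_expKernel 0) t
  have hae : ∀ᵐ q ∂(simplexMeasure (i + j + 1) (L / 2)).prod (simplexMeasure (i + j + 1) (L / 2)),
      (∀ t, 0 < q.1 t) ∧ ∀ t, 0 < q.2 t :=
    (Measure.quasiMeasurePreserving_fst.ae (ae_simplexMeasure_pos _ _)).and
      (Measure.quasiMeasurePreserving_snd.ae (ae_simplexMeasure_pos _ _))
  rw [lintegral_congr_ae (hae.mono fun q hq =>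
    ofReal_boundaryIntegrand (Nat.le_add_right i j) u hq.1 hq.2),
    lintegral_prod_mul hm1.aemeasurable hm2.aemeasurable,
    lintegral_simplexMeasure_prod_kernelSeqCons _ _ _ (measurable_firstKernel _)
      (fun x hx => halfLine_of_nonpos _ hx) (measurable_lastKernel _)
      (fun x hx => halfLine_of_nonpos _ hx),
    lintegral_simplexMeasure_prod_kernelSeqCons _ _ _ (measurable_expKernel _)
      (fun x hx => halfLine_of_nonpos _ hx) (measurable_expKernel _)
      (fun x hx => halfLine_of_nonpos _ hx),
    firstKernel_lconvolution_lastKernel hu, kernelIterate_smul ENNReal.ofReal_ne_top,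
    kernelIterate_expKernel, kernelIterate_expKernel]
  rfl

theorem halfLine_ne_top (h : ℝ → ℝ) (x : ℝ) : halfLine h x ≠ ∞ := by
  rcases le_or_gt x 0 with hx | hx
  · simp [halfLine_of_nonpos _ hx]
  · simp [halfLine_of_pos _ hx]

theorem integrable_boundaryIntegrand (i j : ℕ) {L u : ℝ} (hu : |u| < 1 / 2) :
    Integrable (boundaryIntegrand (i + j + 1) (i + 2) u)
      ((simplexMeasure (i + j + 1) (L / 2)).prod (simplexMeasure (i + j + 1) (L / 2))) := by
  refine ⟨(measurable_boundaryIntegrand _ _ _).aestronglyMeasurable, ?_⟩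
  rw [hasFiniteIntegral_iff_ofReal (Filter.Eventually.of_forall
    (boundaryIntegrand_nonneg (i + j + 1) (i + 2) u))]
  rw [lintegral_boundaryIntegrand i j hu]
  exact ENNReal.mul_lt_top (ENNReal.mul_lt_top ENNReal.ofReal_lt_top (halfLine_ne_top _ _).lt_top)
    (halfLine_ne_top _ _).lt_top

theorem simplexExpIntegral_nonneg (i j : ℕ) (a : ℝ) {y : ℝ} (hy : 0 ≤ y) :
    0 ≤ simplexExpIntegral i j a y := by
  refine intervalIntegral.integral_nonneg hy fun x hx => ?_
  have h0 := hx.1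
  have h1 := sub_nonneg.2 hx.2
  positivity

theorem toReal_halfLine_simplexExpIntegral (i j : ℕ) (a : ℝ) {y : ℝ} (hy : 0 ≤ y) :
    (halfLine (simplexExpIntegral i j a) y).toReal = simplexExpIntegral i j a y := by
  rcases hy.eq_or_lt with rfl | h
  -- At `y = 0` the half-line function vanishes by definition and the integral by its empty range.
  · simp [halfLine_of_nonpos, simplexExpIntegral]
  · rw [halfLine_of_pos _ h, ENNReal.toReal_ofReal (simplexExpIntegral_nonneg _ _ _ hy)]

theorem boundaryE_eq (i j : ℕ) {L u : ℝ} (hL : 0 ≤ L) (hu : |u| < 1 / 2) :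
    boundaryE (i + j + 2) (i + 2) L u =
      2 ^ (i + j + 1) * (sinePrefactor u * simplexExpIntegral i j (2 * u) (L / 2) *
        simplexExpIntegral i j (-(2 * u)) (L / 2)) := by
  have hy : 0 ≤ L / 2 := by positivity
  rw [boundaryE]
  change 2 ^ (i + j + 1) * ∫ q, boundaryIntegrand (i + j + 1) (i + 2) u q
    ∂((simplexMeasure (i + j + 1) (L / 2)).prod (simplexMeasure (i + j + 1) (L / 2))) = _
  rw [integral_eq_lintegral_of_nonneg_ae (Filter.Eventually.of_forall
    (boundaryIntegrand_nonneg (i + j + 1) (i + 2) u))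
    (measurable_boundaryIntegrand _ _ _).aestronglyMeasurable]
  have h := lintegral_boundaryIntegrand i j (L := L) hu
  rw [h, ENNReal.toReal_mul, ENNReal.toReal_mul, toReal_halfLine_simplexExpIntegral _ _ _ hy,
    toReal_halfLine_simplexExpIntegral _ _ _ hy, ENNReal.toReal_ofReal (sinePrefactor_nonneg hu)]

/-! ### Expansion in powers of `u` -/

theorem simplexExpIntegral_scale (i j : ℕ) (a y : ℝ) :
    simplexExpIntegral i j a y = y ^ (i + j + 1) * simplexExpIntegral i j (a * y) 1 := by
  rw [simplexExpIntegral, simplexExpIntegral, ← intervalIntegral.integral_const_mul]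
  have h := intervalIntegral.smul_integral_comp_mul_left (a := 0) (b := 1)
    (fun x : ℝ => Real.exp (a * x) * x ^ i / i ! * ((y - x) ^ j / j !)) y
  rw [mul_zero, mul_one] at h
  rw [← h, smul_eq_mul, ← intervalIntegral.integral_const_mul]
  congr 1
  ext x
  rw [show y - y * x = y * (1 - x) by ring, mul_pow, mul_pow, mul_assoc a y x]
  ring

theorem simplexExpIntegral_mul_simplexExpIntegral_neg (i j : ℕ) (a : ℝ) :
    simplexExpIntegral i j a 1 * simplexExpIntegral i j (-a) 1 =
      (∫ z, Real.exp (a * (z.1 - z.2)) * selbergIntegrand i j 0 z ∂unitSquare) /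
        ((i ! : ℝ) * j !) ^ 2 := by
  simp only [simplexExpIntegral]
  rw [intervalIntegral.integral_of_le zero_le_one, intervalIntegral.integral_of_le zero_le_one,
    ← integral_Icc_eq_integral_Ioc, ← integral_Icc_eq_integral_Ioc, ← integral_prod_mul,
    ← integral_div]
  refine integral_congr_ae (Filter.Eventually.of_forall fun z => ?_)
  simp only [selbergIntegrand]
  rw [show a * (z.1 - z.2) = a * z.1 + -a * z.2 by ring, Real.exp_add, mul_pow (1 - z.1)]
  field_simp
  ring

/-- Averaging over the exchange of the two coordinates removes the odd part of the exponential. -/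
theorem integral_exp_mul_selbergIntegrand (i j : ℕ) (a : ℝ) :
    ∫ z, Real.exp (a * (z.1 - z.2)) * selbergIntegrand i j 0 z ∂unitSquare =
      ∫ z, Real.cosh (a * (z.1 - z.2)) * selbergIntegrand i j 0 z ∂unitSquare := by
  have h := integral_unitSquare_swap
    fun z => Real.exp (a * (z.1 - z.2)) * selbergIntegrand i j 0 z
  have h2 : ∫ z, Real.cosh (a * (z.1 - z.2)) * selbergIntegrand i j 0 z ∂unitSquare =
      (∫ z, Real.exp (a * (z.1 - z.2)) * selbergIntegrand i j 0 z ∂unitSquare +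
      ∫ z : ℝ × ℝ, Real.exp (a * (z.swap.1 - z.swap.2)) * selbergIntegrand i j 0 z.swap
        ∂unitSquare) / 2 := by
    rw [← integral_add (Continuous.integrable_unitSquare (by fun_prop))
      (Continuous.integrable_unitSquare (by fun_prop)), ← integral_div]
    congr 1
    ext z
    rw [Real.cosh_eq, Prod.fst_swap, Prod.snd_swap,
      show -(a * (z.1 - z.2)) = a * (z.2 - z.1) by ring]
    simp only [selbergIntegrand, Prod.fst_swap, Prod.snd_swap]
    ring
  rw [h2, h]
  ring

theorem abs_selbergIntegrand_le_one (i j p : ℕ) :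
    ∀ᵐ z ∂unitSquare, ‖selbergIntegrand i j p z‖ ≤ 1 := by
  rw [unitSquare_eq_restrict]
  filter_upwards [ae_restrict_mem (measurableSet_Icc.prod measurableSet_Icc)] with z hz
  obtain ⟨⟨h1, h2⟩, h3, h4⟩ := hz
  have e1 : |z.1 - z.2| ≤ 1 := abs_le.2 ⟨by linarith, by linarith⟩
  have e2 : |z.1 * z.2| ≤ 1 := abs_le.2 ⟨by nlinarith, by nlinarith⟩
  have e3 : |(1 - z.1) * (1 - z.2)| ≤ 1 := abs_le.2 ⟨by nlinarith, by nlinarith⟩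
  rw [selbergIntegrand, Real.norm_eq_abs, abs_mul, abs_mul, abs_pow, abs_pow, abs_pow]
  exact mul_le_one₀ (mul_le_one₀ (pow_le_one₀ (abs_nonneg _) e1) (by positivity)
    (pow_le_one₀ (abs_nonneg _) e2)) (by positivity) (pow_le_one₀ (abs_nonneg _) e3)

/-- Termwise integration of the `cosh` series, each power `(x - y)^{2p}` being absorbed into the
Selberg integrand. As that is bounded by `1` on the square, the series of `cosh |a|` dominates. -/
theorem hasSum_integral_cosh_mul_selbergIntegrand (i j : ℕ) (a : ℝ) :
    HasSum (fun p => a ^ (2 * p) / (2 * p)! * ∫ z, selbergIntegrand i j p z ∂unitSquare)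
      (∫ z, Real.cosh (a * (z.1 - z.2)) * selbergIntegrand i j 0 z ∂unitSquare) := by
  simp only [← integral_const_mul]
  refine hasSum_integral_of_dominated_convergence
    (fun p _ => |a| ^ (2 * p) / (2 * p)!) (fun p => ?_) (fun p => ?_)
    (Filter.Eventually.of_forall fun _ => (Real.hasSum_cosh |a|).summable)
    (integrable_const _) (Filter.Eventually.of_forall fun z => ?_)
  · exact (Continuous.integrable_unitSquare (by fun_prop)).aestronglyMeasurable
  · filter_upwards [abs_selbergIntegrand_le_one i j p] with z hz
    rw [norm_mul, norm_div, norm_pow, Real.norm_eq_abs a, Real.norm_natCast]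
    exact mul_le_of_le_one_right (by positivity) hz
  · have h := (Real.hasSum_cosh (a * (z.1 - z.2))).mul_right (selbergIntegrand i j 0 z)
    have e : (fun p : ℕ => a ^ (2 * p) / (2 * p)! * selbergIntegrand i j p z) =
        fun p : ℕ => (a * (z.1 - z.2)) ^ (2 * p) / (2 * p)! * selbergIntegrand i j 0 z := by
      ext p
      simp only [selbergIntegrand, mul_pow]
      ring
    rwa [e]

theorem hasSum_simplexExpIntegral (i j : ℕ) (a y : ℝ) :
    HasSum (fun p => y ^ (2 * (i + j + p + 1)) * a ^ (2 * p) / (2 * p)! *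
        ((∫ z, selbergIntegrand i j p z ∂unitSquare) / ((i ! : ℝ) * j !) ^ 2))
      (simplexExpIntegral i j a y * simplexExpIntegral i j (-a) y) := by
  have h := (hasSum_integral_cosh_mul_selbergIntegrand i j (a * y)).mul_left
    (y ^ (2 * (i + j + 1)) / ((i ! : ℝ) * j !) ^ 2)
  rw [← integral_exp_mul_selbergIntegrand] at h
  rw [simplexExpIntegral_scale i j a, simplexExpIntegral_scale i j (-a), neg_mul]
  have e : y ^ (i + j + 1) * simplexExpIntegral i j (a * y) 1 *
      (y ^ (i + j + 1) * simplexExpIntegral i j (-(a * y)) 1) = y ^ (2 * (i + j + 1)) *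
      (simplexExpIntegral i j (a * y) 1 * simplexExpIntegral i j (-(a * y)) 1) := by ring
  rw [e, simplexExpIntegral_mul_simplexExpIntegral_neg, mul_div_left_comm, ← mul_div_assoc,
    mul_comm (∫ z, _ ∂_), ← div_mul_eq_mul_div]
  refine (congrArg (fun F => HasSum F _) (funext fun p => ?_)).mpr h
  rw [mul_pow]
  ring

theorem hasSum_sum_simplexExpIntegral (n : ℕ) (a y : ℝ) :
    HasSum (fun p => y ^ (2 * (n + p + 1)) * a ^ (2 * p) / (2 * p)! *
        ((p ! : ℝ) / ((2 * p + 1) * ((n + p + 1)! * n !))))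
      (∑ q ∈ Finset.HasAntidiagonal.antidiagonal n,
        simplexExpIntegral q.1 q.2 a y * simplexExpIntegral q.1 q.2 (-a) y) := by
  have h := hasSum_sum (s := Finset.HasAntidiagonal.antidiagonal n)
    fun q _ => hasSum_simplexExpIntegral q.1 q.2 a y
  convert h using 2 with p
  rw [← sum_antidiagonal_integral_selbergIntegrand, Finset.mul_sum]
  refine Finset.sum_congr rfl fun q hq => ?_
  rw [Finset.HasAntidiagonal.mem_antidiagonal.1 hq]

/-! ### Comparison of coefficients in `r` -/

theorem coeff_hatXB {L u : ℝ} (hL : 0 ≤ L) (hu : |u| < 1 / 2) (n : ℕ) :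
    PowerSeries.coeff n (hatXB L u) = sinePrefactor u * (2 ^ (n + 1) *
      ∑ q ∈ Finset.HasAntidiagonal.antidiagonal n,
        simplexExpIntegral q.1 q.2 (2 * u) (L / 2) *
          simplexExpIntegral q.1 q.2 (-(2 * u)) (L / 2)) := by
  rw [hatXB, PowerSeries.coeff_mk, Finset.mul_sum, Finset.mul_sum]
  -- Here `k = n + 2`, and `ℓ` corresponds to `(i, j) = (ℓ - 2, k - ℓ)`.
  refine (Finset.sum_nbij' (fun q => q.1 + 2) (fun ℓ => (ℓ - 2, n + 2 - ℓ)) ?_ ?_ ?_ ?_ ?_).symm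
  · rintro ⟨i, j⟩ h
    have := Finset.HasAntidiagonal.mem_antidiagonal.1 h
    simp only [Finset.mem_Icc] at this ⊢
    omega
  · intro ℓ h
    rw [Finset.HasAntidiagonal.mem_antidiagonal]
    simp only [Finset.mem_Icc] at h ⊢
    omega
  · rintro ⟨i, j⟩ h
    have := Finset.HasAntidiagonal.mem_antidiagonal.1 h
    simp only [Prod.mk.injEq] at this ⊢
    omega
  · intro ℓ h
    simp only [Finset.mem_Icc] at h ⊢
    omega
  · rintro ⟨i, j⟩ h
    obtain rfl := Finset.HasAntidiagonal.mem_antidiagonal.1 h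
    rw [boundaryE_eq i j hL hu]
    ring

theorem coeff_besselTerm (L u : ℝ) (n p : ℕ) :
    PowerSeries.coeff n (besselTerm L u p) =
      2 ^ (n + 1) * ((L / 2) ^ (2 * (n + p + 1)) * (2 * u) ^ (2 * p) / (2 * p)! *
        ((p ! : ℝ) / ((2 * p + 1) * ((n + p + 1)! * n !)))) := by
  rw [besselTerm, PowerSeries.coeff_C_mul, PowerSeries.coeff_iterate_derivative, besselI0Series,
    PowerSeries.coeff_mk]
  -- Split `(2p+1)!` into its odd factors `(2p+1)‼` and its even factors `(2p)‼ = 2^p p!`.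
  have h1 : ((2 * p + 1)‼ : ℝ) * (2 ^ p * p !) = (2 * p + 1) * (2 * p)! := by
    have := Nat.factorial_eq_mul_doubleFactorial (2 * p)
    rw [Nat.doubleFactorial_two_mul, Nat.factorial_succ] at this
    exact_mod_cast this.symm
  have h2 : ((n ! : ℕ) : ℝ) * ((n + 1).ascFactorial (p + 1) : ℕ) = ((n + p + 1)! : ℕ) := by
    rw [add_assoc]
    exact_mod_cast Nat.factorial_mul_ascFactorial n (p + 1)
  have h3 : (L ^ 2 / 2) ^ (n + p + 1) * 2 ^ p =
      2 ^ (n + 1) * (L / 2) ^ (2 * (n + p + 1)) * 2 ^ (2 * p) := by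
    rw [pow_mul (L / 2), show (L / 2) ^ 2 = L ^ 2 / 2 * (1 / 2) by ring, mul_pow,
      show (2 : ℝ) ^ (n + 1) * ((L ^ 2 / 2) ^ (n + p + 1) * (1 / 2) ^ (n + p + 1)) * 2 ^ (2 * p) =
        (L ^ 2 / 2) ^ (n + p + 1) * 2 ^ p * (2 ^ (n + p + 1) * (1 / 2) ^ (n + p + 1)) by ring,
      ← mul_pow]
    norm_num
  have hn := Nat.factorial_ne_zero n
  have hp := Nat.factorial_ne_zero p
  have hp2 := Nat.factorial_ne_zero (2 * p)
  have hN := Nat.factorial_ne_zero (n + p + 1)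
  have h4 : ((2 * p + 1)‼ : ℝ) = (2 * p + 1) * (2 * p)! / (2 ^ p * p !) :=
    eq_div_of_mul_eq (by positivity) h1
  have h5 : ((n + 1).ascFactorial (p + 1) : ℝ) = (n + p + 1)! / n ! :=
    eq_div_of_mul_eq (by positivity) (by rw [mul_comm]; exact h2)
  rw [h4, h5, ← add_assoc]
  calc _ = (L ^ 2 / 2) ^ (n + p + 1) * 2 ^ p * (u ^ (2 * p) * p ! /
        ((2 * p + 1) * (2 * p)! * ((n + p + 1)! * n !))) := by field_simp
    _ = _ := by rw [h3, mul_pow 2 u]; field_simp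

theorem hasSum_besselTerm {L u : ℝ} (hL : 0 ≤ L) (hu : |u| < 1 / 2) :
    ∃ S : ℝ⟦X⟧, HasSum (besselTerm L u) S ∧ hatXB L u = PowerSeries.C (sinePrefactor u) * S := by
  refine ⟨PowerSeries.mk fun n => 2 ^ (n + 1) * ∑ q ∈ Finset.HasAntidiagonal.antidiagonal n,
    simplexExpIntegral q.1 q.2 (2 * u) (L / 2) * simplexExpIntegral q.1 q.2 (-(2 * u)) (L / 2),
    (PowerSeries.WithPiTopology.hasSum_iff_hasSum_coeff ℝ).2 fun n => ?_, ?_⟩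
  · simp only [coeff_besselTerm, PowerSeries.coeff_mk]
    exact (hasSum_sum_simplexExpIntegral n (2 * u) (L / 2)).mul_left _
  · ext n
    rw [coeff_hatXB hL hu, PowerSeries.coeff_C_mul, PowerSeries.coeff_mk]

theorem mainTheorem10 (L u : ℝ) (hL : 0 ≤ L) (hu : |u| < 1 / 2) :
    (∀ k ℓ : ℕ, 2 ≤ ℓ → ℓ ≤ k →
      Integrable (boundaryIntegrand (k - 1) ℓ u) (polytopeMeasure k L)) ∧
    Summable (besselTerm L u) ∧
    hatXB L u = PowerSeries.C (sinePrefactor u) * ∑' p : ℕ, besselTerm L u p := by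
  refine ⟨fun k ℓ h2 hk => ?_, ?_⟩
  · obtain ⟨i, rfl⟩ := Nat.exists_eq_add_of_le' h2
    obtain ⟨j, rfl⟩ := Nat.exists_eq_add_of_le hk
    rw [show i + 2 + j = i + j + 2 by ring]
    exact integrable_boundaryIntegrand i j hu
  · obtain ⟨S, hS, h⟩ := hasSum_besselTerm hL hu
    exact ⟨hS.summable, by rw [hS.tsum_eq, h]⟩
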